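/- \textbf{Setting.} Let $f:\mathbb R^N\to\mathbb R^N$ be $C^\infty$, $y_n\in\mathbb R^N$, $\mathbf J=f'(y_n)$. Let $\mathbf V\in\mathbb R^{N\times m}$ have orthonormal columns, $\mathbf H\in\mathbb R^{m\times m}$, $\mathbf A=\mathbf V\mathbf H\mathbf V^T$, and $\varphi_k(Z)=\sum_{i\ge0}Z^i/(k+i)!$. For $c\in\mathbb R$ put $\Phi_k(c)\,d=\mathbf V\varphi_k(ch\mathbf H)\mathbf V^Td+\frac1{k!}(d-\mathbf V\mathbf V^Td)$. One step of size $h$ of \textsc{exp4k} (with $\mathbf B=\mathbf A$) and of \textsc{exp4sp} (with $\mathbf B=\mathbf J$) is $k_1=\Phi_1(\frac13)f(y_n)$, $k_2=\Phi_1(\frac23)f(y_n)$, $k_3=\Phi_1(1)f(y_n)$; $w_4=-\frac{7}{300}k_1+\frac{97}{150}k_2-\frac{37}{300}k_3$, $d_4=f(y_n+hw_4)-f(y_n)-h\mathbf Bw_4$; $k_4=\Phi_1(\frac13)d_4$, $k_5=\Phi_1(\frac23)d_4$, $k_6=\Phi_1(1)d_4$; $w_7=\frac{59}{300}k_1-\frac7{75}k_2+\frac{269}{300}k_3+\frac23(k_4+k_5+k_6)$,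 $d_7=f(y_n+hw_7)-f(y_n)-h\mathbf Bw_7$; $k_7=\Phi_1(\frac13)d_7$; $y_{n+1}=y_n+h(k_3+k_4-\frac43k_5+k_6+\frac16k_7)$. One step of \textsc{erow4k} ($\mathbf B=\mathbf A$) and of \textsc{erow4sp} ($\mathbf B=\mathbf J$) is $k_1=\Phi_1(\frac12)f(y_n)$, $w_2=\frac12k_1$, $d_2=f(y_n+hw_2)-f(y_n)-h\mathbf Bw_2$; $k_2=\Phi_1(1)f(y_n)$, $k_3=\Phi_1(1)d_2$, $w_4=k_2+k_3$, $d_4=f(y_n+hw_4)-f(y_n)-h\mathbf Bw_4$; $k_4=\Phi_3(1)d_2$, $k_5=\Phi_4(1)d_2$, $k_6=\Phi_3(1)d_4$, $k_7=\Phi_4(1)d_4$; $y_{n+1}=y_n+h(k_2+16k_4-48k_5-2k_6+12k_7)$. (In the K-type methods all products with $\mathbf A$ are evaluated in the reduced space $\mathbb R^m$ through $\mathbf H$, $\lambda_i=\mathbf V^Tk_i$ and $\sigma_i=\mathbf V^Tw_i$.) A TW-tree is a rooted tree with meagre and fat vertices in which end vertices are meagre and fat vertices have exactly one child; $|\tau|$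 is its number of vertices, $\sigma(\tau)$ its symmetry coefficient. Its elementary differential $F(\tau)$ has a derivative of $f$ at $y_n$ (of the order given by the number of children) for each meagre vertex and $\mathbf A$ for each fat vertex. It is linear if no vertex has more than one child. It is a TK-tree if no linear sub-tree has a fat root. Recolouring a tree means making all vertices of its linear sub-trees meagre. A mapping $h\mapsto y(h)$ determined by such data has B-series coefficients $(a_1,\dots,a_{21})$ up to order four if, for all data ($N$, $m$, $f$, $y_n$, $\mathbf V$, and arbitrary $\mathbf H$), $$y(h)=y_n+\sum_{i=1}^{21}a_i\frac{h^{|\tau_i|}}{\sigma(\tau_i)}F(\tau_i)+O(h^5)\qquad(h\to0^+),$$ with the trees $\tau_i$ listed in the table. For the exact solution of $y'=f(y)$, $y(0)=y_n$, the same definition is used with an arbitrary matrix $\mathbf A\in\mathbb R^{N\times N}$. \textbf{Claim.} (a) The trees $\tau_1,\dots,\tau_{21}$ are, up to isomorphism and without repetition, all TW-trees of order at most four. Each of the four methods and the exact solution has uniquely determined B-series coefficients up to order four. They are | $i$ | $F(\tau_i)$ | exp4k | exp4sp | erow4k | erow4sp | exact | |---|---|---|---|---|---|---| | 1 | $f^J$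 | $1$ | $1$ | $1$ | $1$ | $1$ | | 2 | $f^J_Kf^K$ | $1/2$ | $0$ | $1/2$ | $0$ | $1/2$ | | 3 | $\mathbf A_{JK}f^K$ | $0$ | $1/2$ | $0$ | $1/2$ | $0$ | | 4 | $f^J_{KL}f^Kf^L$ | $1/3$ | $1/3$ | $1/3$ | $1/3$ | $1/3$ | | 5 | $f^J_Kf^K_Lf^L$ | $1/6$ | $0$ | $1/12$ | $0$ | $1/6$ | | 6 | $f^J_K\mathbf A_{KL}f^L$ | $1/120$ | $0$ | $1/12$ | $0$ | $0$ | | 7 | $\mathbf A_{JK}f^K_Lf^L$ | $-1/36$ | $0$ | $1/15$ | $0$ | $0$ | | 8 | $\mathbf A_{JK}\mathbf A_{KL}f^L$ | $7/360$ | $1/6$ | $-1/15$ | $1/6$ | $0$ | | 9 | $f^J_{KLM}f^Kf^Lf^M$ | $1/4$ | $1/4$ | $1/4$ | $1/4$ | $1/4$ | | 10 | $f^J_{KL}f^L_Mf^Mf^K$ | $1/6$ | $0$ | $1/12$ | $0$ | $1/8$ | | 11 | $f^J_{KL}\mathbf A_{LM}f^Mf^K$ | $-1/24$ | $1/8$ |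 $1/24$ | $1/8$ | $0$ | | 12 | $f^J_Kf^K_{LM}f^Mf^L$ | $1/12$ | $0$ | $1/24$ | $0$ | $1/12$ | | 13 | $\mathbf A_{JK}f^K_{LM}f^Lf^M$ | $0$ | $1/12$ | $1/24$ | $1/12$ | $0$ | | 14 | $f^J_Kf^K_Lf^L_Mf^M$ | $0$ | $0$ | $0$ | $0$ | $1/24$ | | 15 | $f^J_Kf^K_L\mathbf A_{LM}f^M$ | $1/20$ | $0$ | $1/48$ | $0$ | $0$ | | 16 | $f^J_K\mathbf A_{KL}f^L_Mf^M$ | $1/18$ | $0$ | $1/24$ | $0$ | $0$ | | 17 | $f^J_K\mathbf A_{KL}\mathbf A_{LM}f^M$ | $-1537/24300$ | $0$ | $-1/48$ | $0$ | $0$ | | 18 | $\mathbf A_{JK}f^K_Lf^L_Mf^M$ | $1/36$ | $0$ | $1/120$ | $0$ | $0$ | | 19 | $\mathbf A_{JK}f^K_L\mathbf A_{LM}f^M$ | $-23/720$ | $0$ | $1/80$ | $0$ | $0$ | | 20 | $\mathbf A_{JK}\mathbf A_{KL}f^L_Mf^M$ | $-1/27$ | $0$ | $-1/60$ | $0$ |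 $0$ | | 21 | $\mathbf A_{JK}\mathbf A_{KL}\mathbf A_{LM}f^M$ | $3943/97200$ | $1/24$ | $-1/240$ | $1/24$ | $0$ | (b) For a TK-tree $\tau_j$ of order at most four, the K-condition at $\tau_j$ says that the coefficients of the method at all trees that are recoloured to $\tau_j$ have the same sum as those of the exact solution. \textsc{exp4k} satisfies all these conditions, in particular the additional one at the TK-tree $\tau_{13}$, $F(\tau_{13})=\mathbf A_{JK}f^K_{LM}f^Lf^M$, where both sides are $0$. Each of \textsc{exp4sp}, \textsc{erow4k} and \textsc{erow4sp} satisfies all of them except those at $\tau_{12}$ and $\tau_{13}$, which fail. (c) Now let the columns of $\mathbf V$ be an orthonormal basis of the Krylov space $\mathcal K_M=\mathrm{span}\{f(y_n),\mathbf Jf(y_n),\dots,\mathbf J^{M-1}f(y_n)\}$ and $\mathbf H=\mathbf V^T\mathbf J\mathbf V$. A method has order $p$ if its local error after one step from an exact value is $O(h^{p+1})$ as $h\to0^+$, for every $N$, every $C^\infty$ function $f$ and every $y_n$. With $M\ge4$, \textsc{exp4k} has order four. With $M\ge3$, each of \textsc{exp4sp}, \textsc{erow4k} and \textsc{erow4sp}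 has order three. For no $M\ge3$ do these three methods have order four, even if only problems with $\dim\mathcal K_M=M$ are admitted. -/

import Mathlib

open Set Filter Topology Asymptotics
open scoped ContDiff Nat

/-- Trees with two kinds of vertices: fat vertices are singly branched, meagre vertices may have
any number of children, end vertices are meagre. Children are numbered; see `TWTree.Iso`. -/
inductive TWTree : Type
  | meagre (m : ℕ) (c : Fin m → TWTree) : TWTree
  | fat (t : TWTree) : TWTree

namespace TWTree

/-- The number of vertices. -/
def order : TWTree → ℕ
  | meagre _ c => 1 + ∑ i, (c i).order
  | fat t => 1 + t.order

/-- Equality of trees up to renumbering the children of each vertex. -/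
def Iso : TWTree → TWTree → Prop
  | meagre m c, meagre n d => ∃ e : Fin m ≃ Fin n, ∀ i, Iso (c i) (d (e i))
  | fat s, fat t => Iso s t
  | meagre _ _, fat _ => False
  | fat _, meagre _ _ => False

/-- The symmetry coefficient (the number of automorphisms of the rooted coloured tree). -/
noncomputable def symmetry : TWTree → ℕ
  | meagre m c =>
      Nat.card {e : Equiv.Perm (Fin m) // ∀ i, Iso (c i) (c (e i))} * ∏ i, (c i).symmetry
  | fat t => t.symmetry

/-- The elementary differential: a meagre vertex with `m` children is the `m`-th derivative of `f`
at `y`, a fat vertex is the matrix `A`. -/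
noncomputable def elemDiff {E : Type*} [NormedAddCommGroup E] [NormedSpace ℝ E]
    (A : E →L[ℝ] E) (f : E → E) (y : E) : TWTree → E
  | meagre m c => iteratedFDeriv ℝ m f y (fun i => elemDiff A f y (c i))
  | fat t => A (elemDiff A f y t)

/-- Every vertex has at most one child. -/
def IsLinear : TWTree → Prop
  | meagre m c => m ≤ 1 ∧ ∀ i, IsLinear (c i)
  | fat t => IsLinear t

/-- TK-trees: no linear sub-tree has a fat root. -/
def IsTK : TWTree → Prop
  | meagre _ c => ∀ i, IsTK (c i)
  | fat t => ¬ IsLinear t ∧ IsTK t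

open Classical in
/-- Recolour the vertices of all linear sub-trees to meagre. -/
noncomputable def recolor : TWTree → TWTree
  | meagre m c => meagre m (fun i => recolor (c i))
  | fat t => if IsLinear t then meagre 1 ![recolor t] else fat (recolor t)

/-- The tree with one vertex. -/
def leaf : TWTree := meagre 0 ![]

/-- Graft one tree onto a meagre root. -/
def m1 (t : TWTree) : TWTree := meagre 1 ![t]

/-- Graft two trees onto a meagre root. -/
def m2 (s t : TWTree) : TWTree := meagre 2 ![s, t]

/-- Graft three trees onto a meagre root. -/
def m3 (s t u : TWTree) : TWTree := meagre 3 ![s, t, u]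

/-- The trees `τ₁, …, τ₂₁` of order at most four; `tau i` is `τ_{i+1}`. -/
def tau : Fin 21 → TWTree :=
  ![leaf,
    m1 leaf, fat leaf,
    m2 leaf leaf,
    m1 (m1 leaf), m1 (fat leaf), fat (m1 leaf), fat (fat leaf),
    m3 leaf leaf leaf,
    m2 leaf (m1 leaf), m2 leaf (fat leaf),
    m1 (m2 leaf leaf), fat (m2 leaf leaf),
    m1 (m1 (m1 leaf)), m1 (m1 (fat leaf)), m1 (fat (m1 leaf)), m1 (fat (fat leaf)),
    fat (m1 (m1 leaf)), fat (m1 (fat leaf)), fat (fat (m1 leaf)), fat (fat (fat leaf))]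

end TWTree

/-- Euclidean space `ℝⁿ`. -/
abbrev Rn (n : ℕ) : Type := EuclideanSpace ℝ (Fin n)

/-- The matrix function `φ_k(Z) = ∑ᵢ Zⁱ / (k + i)!`. -/
noncomputable def phi {n : ℕ} (k : ℕ) (Z : Rn n →L[ℝ] Rn n) : Rn n →L[ℝ] Rn n :=
  ∑' i : ℕ, ((k + i)! : ℝ)⁻¹ • Z ^ i

/-- The transpose of a matrix with orthonormal columns. -/
noncomputable def tr {N m : ℕ} (V : Rn m →ₗᵢ[ℝ] Rn N) : Rn N →L[ℝ] Rn m :=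
  ContinuousLinearMap.adjoint V.toContinuousLinearMap

/-- `V H Vᵀ`. -/
noncomputable def approxJac {N m : ℕ} (V : Rn m →ₗᵢ[ℝ] Rn N) (H : Rn m →L[ℝ] Rn m) :
    Rn N →L[ℝ] Rn N :=
  V.toContinuousLinearMap ∘L H ∘L tr V

/-- `Vᵀ J V`. -/
noncomputable def reducedJac {N m : ℕ} (V : Rn m →ₗᵢ[ℝ] Rn N) (J : Rn N →L[ℝ] Rn N) :
    Rn m →L[ℝ] Rn m :=
  tr V ∘L J ∘L V.toContinuousLinearMap

/-- One step of a method, as a function of the right hand side `f`, the current value `y`, the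
matrix `V` with orthonormal columns, the small matrix `H` and the step size `h`. -/
abbrev Method : Type :=
  ∀ (N m : ℕ), (Rn N → Rn N) → Rn N → (Rn m →ₗᵢ[ℝ] Rn N) → (Rn m →L[ℝ] Rn m) → ℝ → Rn N

/-- The K-type implementation of exp4. -/
noncomputable def exp4k : Method := fun _ _ f y V H h =>
  let ψ₀ := tr V (f y)
  let p₀ := f y - V ψ₀
  let l₁ := phi 1 (((1 : ℝ) / 3 * h) • H) ψ₀
  let l₂ := phi 1 (((2 : ℝ) / 3 * h) • H) ψ₀
  let l₃ := phi 1 (h • H) ψ₀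
  let k₁ := V l₁ + p₀
  let k₂ := V l₂ + p₀
  let k₃ := V l₃ + p₀
  let w₄ := (-7 / 300 : ℝ) • k₁ + (97 / 150 : ℝ) • k₂ - (37 / 300 : ℝ) • k₃
  let s₄ := (-7 / 300 : ℝ) • l₁ + (97 / 150 : ℝ) • l₂ - (37 / 300 : ℝ) • l₃
  let u₄ := y + h • w₄
  let ψ₄ := tr V (f u₄)
  let p₄ := f u₄ - V ψ₄
  let δ₄ := ψ₄ - ψ₀ - h • H s₄
  let l₄ := phi 1 (((1 : ℝ) / 3 * h) • H) δ₄
  let l₅ := phi 1 (((2 : ℝ) / 3 * h) • H) δ₄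
  let l₆ := phi 1 (h • H) δ₄
  let k₄ := V l₄ + p₄ - p₀
  let k₅ := V l₅ + p₄ - p₀
  let k₆ := V l₆ + p₄ - p₀
  let w₇ := (59 / 300 : ℝ) • k₁ - (7 / 75 : ℝ) • k₂ + (269 / 300 : ℝ) • k₃
    + (2 / 3 : ℝ) • (k₄ + k₅ + k₆)
  let s₇ := (59 / 300 : ℝ) • l₁ - (7 / 75 : ℝ) • l₂ + (269 / 300 : ℝ) • l₃
    + (2 / 3 : ℝ) • (l₄ + l₅ + l₆)
  let u₇ := y + h • w₇
  let ψ₇ := tr V (f u₇)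
  let p₇ := f u₇ - V ψ₇
  let δ₇ := ψ₇ - ψ₀ - h • H s₇
  let l₇ := phi 1 (((1 : ℝ) / 3 * h) • H) δ₇
  let k₇ := V l₇ + p₇ - p₀
  y + h • (k₃ + k₄ - (4 / 3 : ℝ) • k₅ + k₆ + (1 / 6 : ℝ) • k₇)

/-- The single projection implementation of exp4. -/
noncomputable def exp4sp : Method := fun _ _ f y V H h =>
  let J := fderiv ℝ f y
  let ψ₀ := tr V (f y)
  let p₀ := f y - V ψ₀
  let l₁ := phi 1 (((1 : ℝ) / 3 * h) • H) ψ₀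
  let l₂ := phi 1 (((2 : ℝ) / 3 * h) • H) ψ₀
  let l₃ := phi 1 (h • H) ψ₀
  let k₁ := V l₁ + p₀
  let k₂ := V l₂ + p₀
  let k₃ := V l₃ + p₀
  let w₄ := (-7 / 300 : ℝ) • k₁ + (97 / 150 : ℝ) • k₂ - (37 / 300 : ℝ) • k₃
  let u₄ := y + h • w₄
  let d₄ := f u₄ - f y - h • J w₄
  let ψ₄ := tr V d₄
  let q₄ := d₄ - V ψ₄
  let l₄ := phi 1 (((1 : ℝ) / 3 * h) • H) ψ₄
  let l₅ := phi 1 (((2 : ℝ) / 3 * h) • H) ψ₄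
  let l₆ := phi 1 (h • H) ψ₄
  let k₄ := V l₄ + q₄
  let k₅ := V l₅ + q₄
  let k₆ := V l₆ + q₄
  let w₇ := (59 / 300 : ℝ) • k₁ - (7 / 75 : ℝ) • k₂ + (269 / 300 : ℝ) • k₃
    + (2 / 3 : ℝ) • (k₄ + k₅ + k₆)
  let u₇ := y + h • w₇
  let d₇ := f u₇ - f y - h • J w₇
  let ψ₇ := tr V d₇
  let q₇ := d₇ - V ψ₇
  let l₇ := phi 1 (((1 : ℝ) / 3 * h) • H) ψ₇
  let k₇ := V l₇ + q₇
  y + h • (k₃ + k₄ - (4 / 3 : ℝ) • k₅ + k₆ + (1 / 6 : ℝ) • k₇)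

/-- The K-type implementation of erow4. -/
noncomputable def erow4k : Method := fun _ _ f y V H h =>
  let ψ₀ := tr V (f y)
  let p₀ := f y - V ψ₀
  let l₁ := phi 1 (((1 : ℝ) / 2 * h) • H) ψ₀
  let k₁ := V l₁ + p₀
  let w₂ := (1 / 2 : ℝ) • k₁
  let s₂ := (1 / 2 : ℝ) • l₁
  let u₂ := y + h • w₂
  let ψ₂ := tr V (f u₂)
  let p₂ := f u₂ - V ψ₂
  let δ₂ := ψ₂ - ψ₀ - h • H s₂
  let l₂ := phi 1 (h • H) ψ₀
  let k₂ := V l₂ + p₀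
  let l₃ := phi 1 (h • H) δ₂
  let k₃ := V l₃ + p₂ - p₀
  let w₄ := k₂ + k₃
  let s₄ := l₂ + l₃
  let u₄ := y + h • w₄
  let ψ₄ := tr V (f u₄)
  let p₄ := f u₄ - V ψ₄
  let δ₄ := ψ₄ - ψ₀ - h • H s₄
  let l₄ := phi 3 (h • H) δ₂
  let k₄ := V l₄ + ((3 ! : ℝ)⁻¹) • (p₂ - p₀)
  let l₅ := phi 4 (h • H) δ₂
  let k₅ := V l₅ + ((4 ! : ℝ)⁻¹) • (p₂ - p₀)
  let l₆ := phi 3 (h • H) δ₄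
  let k₆ := V l₆ + ((3 ! : ℝ)⁻¹) • (p₄ - p₀)
  let l₇ := phi 4 (h • H) δ₄
  let k₇ := V l₇ + ((4 ! : ℝ)⁻¹) • (p₄ - p₀)
  y + h • (k₂ + (16 : ℝ) • k₄ - (48 : ℝ) • k₅ - (2 : ℝ) • k₆ + (12 : ℝ) • k₇)

/-- The single projection implementation of erow4. -/
noncomputable def erow4sp : Method := fun _ _ f y V H h =>
  let J := fderiv ℝ f y
  let ψ₀ := tr V (f y)
  let p₀ := f y - V ψ₀
  let l₁ := phi 1 (((1 : ℝ) / 2 * h) • H) ψ₀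
  let k₁ := V l₁ + p₀
  let w₂ := (1 / 2 : ℝ) • k₁
  let u₂ := y + h • w₂
  let d₂ := f u₂ - f y - h • J w₂
  let ψ₂ := tr V d₂
  let q₂ := d₂ - V ψ₂
  let l₂ := phi 1 (h • H) ψ₀
  let k₂ := V l₂ + p₀
  let l₃ := phi 1 (h • H) ψ₂
  let k₃ := V l₃ + q₂
  let w₄ := k₂ + k₃
  let u₄ := y + h • w₄
  let d₄ := f u₄ - f y - h • J w₄
  let ψ₄ := tr V d₄
  let q₄ := d₄ - V ψ₄
  let l₄ := phi 3 (h • H) ψ₂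
  let k₄ := V l₄ + ((3 ! : ℝ)⁻¹) • q₂
  let l₅ := phi 4 (h • H) ψ₂
  let k₅ := V l₅ + ((4 ! : ℝ)⁻¹) • q₂
  let l₆ := phi 3 (h • H) ψ₄
  let k₆ := V l₆ + ((3 ! : ℝ)⁻¹) • q₄
  let l₇ := phi 4 (h • H) ψ₄
  let k₇ := V l₇ + ((4 ! : ℝ)⁻¹) • q₄
  y + h • (k₂ + (16 : ℝ) • k₄ - (48 : ℝ) • k₅ - (2 : ℝ) • k₆ + (12 : ℝ) • k₇)

/-- The B-series with coefficient `1` at the empty tree and `a i` at `tau i`, truncated after the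
trees of order four. -/
noncomputable def bSeries4 {N : ℕ} (a : Fin 21 → ℝ) (A : Rn N →L[ℝ] Rn N) (f : Rn N → Rn N)
    (y : Rn N) (h : ℝ) : Rn N :=
  y + ∑ i, (a i * (h ^ (TWTree.tau i).order / ((TWTree.tau i).symmetry : ℝ))) •
    TWTree.elemDiff A f y (TWTree.tau i)

/-- `a` is the vector of B-series coefficients of the method up to order four. As usual for
TW-trees, `H`, hence `A = V H Vᵀ`, need not be related to the Jacobian of `f`. -/
def HasBSeries (Φ : Method) (a : Fin 21 → ℝ) : Prop :=
  ∀ (N m : ℕ) (f : Rn N → Rn N) (y : Rn N) (V : Rn m →ₗᵢ[ℝ] Rn N) (H : Rn m →L[ℝ] Rn m),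
    ContDiff ℝ ∞ f →
    (fun h : ℝ => Φ N m f y V H h - bSeries4 a (approxJac V H) f y h)
      =O[𝓝[>] (0 : ℝ)] (fun h : ℝ => h ^ 5)

/-- `z` solves `z' = f(z)`, `z(0) = y` on some interval `[0, T]`. -/
def IsSolution {N : ℕ} (f : Rn N → Rn N) (y : Rn N) (z : ℝ → Rn N) : Prop :=
  z 0 = y ∧ ∃ T : ℝ, 0 < T ∧ ∀ t ∈ Icc 0 T, HasDerivWithinAt z (f (z t)) (Icc 0 T) t

/-- `a` is the vector of B-series coefficients of the exact solution up to order four. -/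
def ExactHasBSeries (a : Fin 21 → ℝ) : Prop :=
  ∀ (N : ℕ) (f : Rn N → Rn N) (y : Rn N) (A : Rn N →L[ℝ] Rn N) (z : ℝ → Rn N),
    ContDiff ℝ ∞ f → IsSolution f y z →
    (fun h : ℝ => z h - bSeries4 a A f y h) =O[𝓝[>] (0 : ℝ)] (fun h : ℝ => h ^ 5)

/-- The columns of `V` form an orthonormal basis of `span {v, J v, …, J^(M-1) v}`. -/
def IsKrylovBasis {N m : ℕ} (M : ℕ) (J : Rn N →L[ℝ] Rn N) (v : Rn N)
    (V : Rn m →ₗᵢ[ℝ] Rn N) : Prop :=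
  LinearMap.range V.toLinearMap = Submodule.span ℝ (Set.range fun i : Fin M => (J ^ (i : ℕ)) v)

/-- The method has order (at least) `p` if it is used with Krylov spaces generated by `M` vectors
and of dimension `m`. (The dimension is `m = M`, unless the Krylov sequence breaks down.) -/
def HasOrder (Φ : Method) (M m p : ℕ) : Prop :=
  ∀ (N : ℕ) (f : Rn N → Rn N) (y : Rn N) (V : Rn m →ₗᵢ[ℝ] Rn N) (z : ℝ → Rn N),
    ContDiff ℝ ∞ f → IsKrylovBasis M (fderiv ℝ f y) (f y) V → IsSolution f y z →
    (fun h : ℝ => Φ N m f y V (reducedJac V (fderiv ℝ f y)) h - z h)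
      =O[𝓝[>] (0 : ℝ)] (fun h : ℝ => h ^ (p + 1))

/-- The table of coefficients: exp4k. -/
noncomputable def exp4kCoeff : Fin 21 → ℝ :=
  ![1,
    1 / 2, 0,
    1 / 3,
    1 / 6, 1 / 120, -1 / 36, 7 / 360,
    1 / 4,
    1 / 6, -1 / 24,
    1 / 12, 0,
    0, 1 / 20, 1 / 18, -1537 / 24300, 1 / 36, -23 / 720, -1 / 27, 3943 / 97200]

/-- The table of coefficients: exp4sp. -/
noncomputable def exp4spCoeff : Fin 21 → ℝ :=
  ![1,
    0, 1 / 2,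
    1 / 3,
    0, 0, 0, 1 / 6,
    1 / 4,
    0, 1 / 8,
    0, 1 / 12,
    0, 0, 0, 0, 0, 0, 0, 1 / 24]

/-- The table of coefficients: erow4k. -/
noncomputable def erow4kCoeff : Fin 21 → ℝ :=
  ![1,
    1 / 2, 0,
    1 / 3,
    1 / 12, 1 / 12, 1 / 15, -1 / 15,
    1 / 4,
    1 / 12, 1 / 24,
    1 / 24, 1 / 24,
    0, 1 / 48, 1 / 24, -1 / 48, 1 / 120, 1 / 80, -1 / 60, -1 / 240]

/-- The table of coefficients: erow4sp. -/
noncomputable def erow4spCoeff : Fin 21 → ℝ :=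
  ![1,
    0, 1 / 2,
    1 / 3,
    0, 0, 0, 1 / 6,
    1 / 4,
    0, 1 / 8,
    0, 1 / 12,
    0, 0, 0, 0, 0, 0, 0, 1 / 24]

/-- The table of coefficients: exact solution. -/
noncomputable def exactCoeff : Fin 21 → ℝ :=
  ![1,
    1 / 2, 0,
    1 / 3,
    1 / 6, 0, 0, 0,
    1 / 4,
    1 / 8, 0,
    1 / 12, 0,
    1 / 24, 0, 0, 0, 0, 0, 0, 0]

open Classical in
/-- The sum of the coefficients of all trees that are recoloured to `tau j`. -/
noncomputable def mergedCoeff (a : Fin 21 → ℝ) (j : Fin 21) : ℝ :=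
  ∑ i with TWTree.Iso (TWTree.recolor (TWTree.tau i)) (TWTree.tau j), a i

/-- The order condition for K-methods at the TK-tree `tau j`. -/
def KCondition (a : Fin 21 → ℝ) (j : Fin 21) : Prop :=
  mergedCoeff a j = mergedCoeff exactCoeff j

/-! Everything reduces to finite arithmetic on vectors of 21 coefficients. A map `g` is said to have
an expansion when it agrees, up to a power of `h`, with a combination of the scaled elementary
differentials (`HasExpansion`). Each operation in a method acts on such vectors: multiplication by
`h A` or `h f'(y)` grafts trees onto a fat or meagre root (`smul_fat`, `smul_fderiv`), the map `f(y
+ h g)` is handled by Taylor's formula (`HasExpansion.comp`), and `Φ_k(c)` by the recurrence `φ_k(Z)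
= 1/k! + Z φ_{k+1}(Z)` (`HasExpansion.phiOp`). A K-type method and its single projection variant are
the same scheme, with `A` or `J` in the defects, so two symbolic runs per scheme produce the four
columns of the table. For the exact solution, `z' = f(z)` turns the order gained by composition into
a bootstrap (`IsSolution.hasExpansion_succ`).

Uniqueness of the coefficients comes from a polynomial vector field on the free space over the 21
trees whose scaled elementary differentials are the basis vectors (`scaledDiff_universalField`), so
that coefficients are read off as coordinates.

For the orders, `A` agrees with `J` on all Krylov vectors but the last one. Trees with the same
recolouring at linear sub-trees then have equal elementary differentials, and only the merged sums
of coefficients matter; `A` applied to the second derivative cannot be simplified and accounts for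
the additional condition. The methods other than exp4k fail to have order four because of their
coefficient at `tau 11`: if the second derivative takes values orthogonal to the Krylov space, where
`A` vanishes but `J` does not, nothing can compensate for it (`HasBSeries.not_hasOrder_four`). -/

set_option maxSynthPendingDepth 3

/-! ### Classification, symmetry and recolouring of the trees of order at most four -/

namespace TWTree

theorem order_pos (t : TWTree) : 1 ≤ t.order := by
  cases t <;> simp [order]

theorem Iso.order_eq : ∀ {s t : TWTree}, Iso s t → s.order = t.order
  | meagre m c, meagre n d, h => by
      obtain ⟨e, he⟩ := h
      simp only [order]
      rw [← Equiv.sum_comp e]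
      exact congrArg _ (Finset.sum_congr rfl fun i _ => (he i).order_eq)
  | fat s, fat t, h => by
      simp only [Iso] at h
      simp only [order, h.order_eq]
  | meagre _ _, fat _, h => by simp [Iso] at h
  | fat _, meagre _ _, h => by simp [Iso] at h

/-- An isomorphism invariant which separates the trees of order at most four. -/
def code : TWTree → ℕ
  | meagre _ c => 2 * (∑ i, (c i).code ^ 2) + 1
  | fat t => 2 * t.code + 2

theorem Iso.code_eq : ∀ {s t : TWTree}, Iso s t → s.code = t.code
  | meagre m c, meagre n d, h => by
      obtain ⟨e, he⟩ := h
      simp only [code]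
      rw [← Equiv.sum_comp e (fun i => (d i).code ^ 2)]
      congr 2
      exact Finset.sum_congr rfl fun i _ => by rw [(he i).code_eq]
  | fat s, fat t, h => by
      simp only [Iso] at h
      simp only [code, h.code_eq]
  | meagre _ _, fat _, h => by simp [Iso] at h
  | fat _, meagre _ _, h => by simp [Iso] at h

theorem Iso.refl : ∀ t : TWTree, Iso t t
  | meagre _ c => ⟨Equiv.refl _, fun i => Iso.refl (c i)⟩
  | fat t => by simpa only [Iso] using Iso.refl t

@[simp] theorem code_leaf : leaf.code = 1 := by simp [leaf, code]
@[simp] theorem code_m1 (t) : (m1 t).code = 2 * t.code ^ 2 + 1 := by simp [m1, code]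
@[simp] theorem code_m2 (s t) : (m2 s t).code = 2 * (s.code ^ 2 + t.code ^ 2) + 1 := by
  simp [m2, code]
@[simp] theorem code_m3 (s t u) :
    (m3 s t u).code = 2 * (s.code ^ 2 + t.code ^ 2 + u.code ^ 2) + 1 := by
  simp [m3, code, Fin.sum_univ_three]
@[simp] theorem code_fat (t) : (fat t).code = 2 * t.code + 2 := by simp [code]

@[simp] theorem order_leaf : leaf.order = 1 := by simp [leaf, order]
@[simp] theorem order_m1 (t) : (m1 t).order = 1 + t.order := by simp [m1, order]
@[simp] theorem order_m2 (s t) : (m2 s t).order = 1 + (s.order + t.order) := by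
  simp [m2, order]
@[simp] theorem order_m3 (s t u) : (m3 s t u).order = 1 + (s.order + t.order + u.order) := by
  simp [m3, order, Fin.sum_univ_three]
@[simp] theorem order_fat (t) : (fat t).order = 1 + t.order := by simp [order]

/-- The orders of the trees `tau i`. -/
def ord : Fin 21 → ℕ := ![1, 2, 2, 3, 3, 3, 3, 3, 4, 4, 4, 4, 4, 4, 4, 4, 4, 4, 4, 4, 4]

theorem order_tau (i : Fin 21) : (tau i).order = ord i := by
  fin_cases i <;> simp [tau, ord]

theorem ord_le (i : Fin 21) : ord i ≤ 4 := by
  revert i; decide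

/-- The 21 values of `code` are pairwise different. Parity tells a fat root from a meagre one; the
squares are needed because plain sums would give `m3 leaf leaf leaf` and `m1 (m1 leaf)` the same
value 7. -/
theorem tau_injective {i j : Fin 21} (h : Iso (tau i) (tau j)) : i = j := by
  have key : ∀ i, (tau i).code =
      (![1, 3, 4, 5, 19, 33, 8, 10, 7, 21, 35, 51, 12, 723, 2179, 129, 201, 40, 68, 18, 22] :
        Fin 21 → ℕ) i := by
    intro i
    fin_cases i <;> simp [tau]
  have h' := h.code_eq
  rw [key, key] at h'
  clear h key
  revert i j
  decide

theorem iso_meagre_one {c : Fin 1 → TWTree} {t : TWTree} (h : Iso (c 0) t) :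
    Iso (meagre 1 c) (m1 t) :=
  ⟨Equiv.refl _, fun i => by rw [Subsingleton.elim i 0]; exact h⟩

theorem iso_meagre_two {c : Fin 2 → TWTree} {s t : TWTree} (h : Iso (c 0) s) (h' : Iso (c 1) t) :
    Iso (meagre 2 c) (m2 s t) :=
  ⟨Equiv.refl _, fun i => by fin_cases i <;> assumption⟩

/-- The list `tau` puts the leaf first in trees of the form `m2 leaf _`, whereas an arbitrary tree
may carry its larger child first. -/
theorem iso_meagre_two_swap {c : Fin 2 → TWTree} {s t : TWTree} (h : Iso (c 1) s)
    (h' : Iso (c 0) t) : Iso (meagre 2 c) (m2 s t) :=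
  ⟨Equiv.swap 0 1, fun i => by fin_cases i <;> assumption⟩

theorem iso_meagre_three {c : Fin 3 → TWTree} {s t u : TWTree} (h : Iso (c 0) s)
    (h' : Iso (c 1) t) (h'' : Iso (c 2) u) : Iso (meagre 3 c) (m3 s t u) :=
  ⟨Equiv.refl _, fun i => by fin_cases i <;> assumption⟩

theorem iso_fat {s t : TWTree} (h : Iso s t) : Iso (fat s) (fat t) := by
  simpa only [Iso] using h

theorem iso_leaf_of_order {t : TWTree} (h : t.order ≤ 1) : Iso t leaf := by
  match t with
  | fat t => have := t.order_pos; simp at h; omega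
  | meagre 0 c => exact ⟨Equiv.refl _, fun i => i.elim0⟩
  | meagre (n + 1) c =>
    have := (c 0).order_pos
    simp only [order, Fin.sum_univ_succ] at h
    omega

theorem iso_of_order_two {t : TWTree} (h : t.order = 2) :
    Iso t (m1 leaf) ∨ Iso t (fat leaf) := by
  match t with
  | fat t => exact .inr (iso_fat (iso_leaf_of_order (by simp at h; omega)))
  | meagre 0 c => simp [order] at h
  | meagre 1 c =>
    simp only [order, Fin.sum_univ_succ, Fin.sum_univ_zero] at h
    exact .inl (iso_meagre_one (iso_leaf_of_order (by omega)))
  | meagre (n + 2) c =>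
    have h0 := (c 0).order_pos
    have h1 := (c 1).order_pos
    simp only [order, Fin.sum_univ_succ, Fin.succ_zero_eq_one] at h
    omega

theorem iso_of_order_three {t : TWTree} (h : t.order = 3) :
    Iso t (m2 leaf leaf) ∨ Iso t (m1 (m1 leaf)) ∨ Iso t (m1 (fat leaf)) ∨
      Iso t (fat (m1 leaf)) ∨ Iso t (fat (fat leaf)) := by
  match t with
  | fat t =>
    rcases iso_of_order_two (t := t) (by simp at h; omega) with h | h
    · exact .inr (.inr (.inr (.inl (iso_fat h))))
    · exact .inr (.inr (.inr (.inr (iso_fat h))))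
  | meagre 0 c => simp [order] at h
  | meagre 1 c =>
    simp only [order, Fin.sum_univ_succ, Fin.sum_univ_zero] at h
    rcases iso_of_order_two (t := c 0) (by omega) with h | h
    · exact .inr (.inl (iso_meagre_one h))
    · exact .inr (.inr (.inl (iso_meagre_one h)))
  | meagre 2 c =>
    have h0 := (c 0).order_pos
    have h1 := (c 1).order_pos
    simp only [order, Fin.sum_univ_two] at h
    exact .inl (iso_meagre_two (iso_leaf_of_order (by omega)) (iso_leaf_of_order (by omega)))
  | meagre (n + 3) c =>
    have h0 := (c 0).order_pos
    have h1 := (c (Fin.succ 0)).order_pos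
    have h2 := (c (Fin.succ (Fin.succ 0))).order_pos
    simp only [order, Fin.sum_univ_succ] at h
    omega

theorem exists_iso_tau {t : TWTree} (h : t.order ≤ 4) : ∃ i, Iso t (tau i) := by
  have pos := t.order_pos
  rcases (by omega : t.order = 1 ∨ t.order = 2 ∨ t.order = 3 ∨ t.order = 4) with h | h | h | h
  · exact ⟨0, iso_leaf_of_order h.le⟩
  · rcases iso_of_order_two h with h | h
    exacts [⟨1, h⟩, ⟨2, h⟩]
  · rcases iso_of_order_three h with h | h | h | h | h
    exacts [⟨3, h⟩, ⟨4, h⟩, ⟨5, h⟩, ⟨6, h⟩, ⟨7, h⟩]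
  match t with
  | fat t =>
    rcases iso_of_order_three (t := t) (by simp at h; omega) with h | h | h | h | h
    exacts [⟨12, iso_fat h⟩, ⟨17, iso_fat h⟩, ⟨18, iso_fat h⟩, ⟨19, iso_fat h⟩, ⟨20, iso_fat h⟩]
  | meagre 0 c => simp [order] at h
  | meagre 1 c =>
    simp only [order, Fin.sum_univ_succ, Fin.sum_univ_zero] at h
    rcases iso_of_order_three (t := c 0) (by omega) with h | h | h | h | h
    exacts [⟨11, iso_meagre_one h⟩, ⟨13, iso_meagre_one h⟩, ⟨14, iso_meagre_one h⟩,
      ⟨15, iso_meagre_one h⟩, ⟨16, iso_meagre_one h⟩]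
  | meagre 2 c =>
    have h0 := (c 0).order_pos
    have h1 := (c 1).order_pos
    simp only [order, Fin.sum_univ_two] at h
    rcases (by omega : (c 0).order ≤ 1 ∧ (c 1).order = 2 ∨ (c 1).order ≤ 1 ∧ (c 0).order = 2) with
      ⟨ha, hb⟩ | ⟨ha, hb⟩
    · rcases iso_of_order_two hb with hb | hb
      exacts [⟨9, iso_meagre_two (iso_leaf_of_order ha) hb⟩,
        ⟨10, iso_meagre_two (iso_leaf_of_order ha) hb⟩]
    · rcases iso_of_order_two hb with hb | hb
      exacts [⟨9, iso_meagre_two_swap (iso_leaf_of_order ha) hb⟩,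
        ⟨10, iso_meagre_two_swap (iso_leaf_of_order ha) hb⟩]
  | meagre 3 c =>
    have h0 := (c 0).order_pos
    have h1 := (c 1).order_pos
    have h2 := (c 2).order_pos
    simp only [order, Fin.sum_univ_three] at h
    exact ⟨8, iso_meagre_three (iso_leaf_of_order (by omega)) (iso_leaf_of_order (by omega))
      (iso_leaf_of_order (by omega))⟩
  | meagre (n + 4) c =>
    have h0 := (c 0).order_pos
    have h1 := (c (Fin.succ 0)).order_pos
    have h2 := (c (Fin.succ (Fin.succ 0))).order_pos
    have h3 := (c (Fin.succ (Fin.succ (Fin.succ 0)))).order_pos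
    simp only [order, Fin.sum_univ_succ] at h
    omega

theorem order_le_four_iff (t : TWTree) : t.order ≤ 4 ↔ ∃ i, Iso t (tau i) :=
  ⟨exists_iso_tau, fun ⟨i, hi⟩ => by rw [hi.order_eq, order_tau]; exact ord_le i⟩

theorem not_iso_of_code_ne {s t : TWTree} (h : s.code ≠ t.code) : ¬ Iso s t :=
  fun h' => h h'.code_eq

@[simp] theorem symmetry_leaf : leaf.symmetry = 1 := by simp [leaf, symmetry]

@[simp] theorem symmetry_m1 (t) : (m1 t).symmetry = t.symmetry := by
  have : Nat.card {e : Equiv.Perm (Fin 1) // ∀ i, Iso (![t] i) (![t] (e i))} = 1 := by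
    rw [Nat.card_eq_one_iff_unique]
    exact ⟨inferInstance, ⟨⟨1, fun i => Iso.refl _⟩⟩⟩
  rw [m1, symmetry, this]
  simp

@[simp] theorem symmetry_m2_self (t) : (m2 t t).symmetry = 2 * t.symmetry ^ 2 := by
  have h (i : Fin 2) : ![t, t] i = t := by fin_cases i <;> rfl
  simp only [m2, symmetry, h, Iso.refl, implies_true, Fin.prod_univ_two]
  rw [Nat.card_congr (Equiv.subtypeUnivEquiv fun _ => trivial), Nat.card_perm]
  simp [sq]

/-- Different codes exclude an isomorphism of the two children, so no automorphism can swap them and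
only the identity permutation remains. -/
theorem symmetry_m2_of_code_ne {s t : TWTree} (h : s.code ≠ t.code) :
    (m2 s t).symmetry = s.symmetry * t.symmetry := by
  have : Nat.card {e : Equiv.Perm (Fin 2) // ∀ i, Iso (![s, t] i) (![s, t] (e i))} = 1 := by
    rw [Nat.card_eq_one_iff_unique]
    refine ⟨⟨?_⟩, ⟨⟨1, fun i => Iso.refl _⟩⟩⟩
    have key : ∀ e : Equiv.Perm (Fin 2), (∀ i, Iso (![s, t] i) (![s, t] (e i))) → e = 1 := by
      intro e he
      have h0 := he 0
      have : e 0 = 0 := by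
        by_contra hne
        have h1 : e 0 = 1 := by omega
        rw [h1] at h0
        exact not_iso_of_code_ne h h0
      clear h0 he
      revert this
      revert e
      decide
    rintro ⟨e, he⟩ ⟨e', he'⟩
    simp [key e he, key e' he']
  rw [m2, symmetry, this]
  simp

@[simp] theorem symmetry_m3_self (t) : (m3 t t t).symmetry = 6 * t.symmetry ^ 3 := by
  have h (i : Fin 3) : ![t, t, t] i = t := by fin_cases i <;> rfl
  simp only [m3, symmetry, h, Iso.refl, implies_true, Fin.prod_univ_three]
  rw [Nat.card_congr (Equiv.subtypeUnivEquiv fun _ => trivial), Nat.card_perm]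
  simp [pow_succ, Nat.factorial]

@[simp] theorem symmetry_fat (t) : (fat t).symmetry = t.symmetry := by simp [symmetry]

theorem symmetry_tau (i : Fin 21) : ((tau i).symmetry : ℝ) =
    (![1, 1, 1, 2, 1, 1, 1, 1, 6, 1, 1, 2, 2, 1, 1, 1, 1, 1, 1, 1, 1] : Fin 21 → ℝ) i := by
  fin_cases i <;> simp [tau, symmetry_m2_of_code_ne]

@[simp] theorem isLinear_leaf : IsLinear leaf := by simp [leaf, IsLinear]
@[simp] theorem isLinear_m1 (t) : IsLinear (m1 t) ↔ IsLinear t := by simp [m1, IsLinear]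
@[simp] theorem isLinear_fat (t) : IsLinear (fat t) ↔ IsLinear t := by simp [IsLinear]
@[simp] theorem not_isLinear_m2 (s t) : ¬ IsLinear (m2 s t) := by simp [m2, IsLinear]
@[simp] theorem not_isLinear_m3 (s t u) : ¬ IsLinear (m3 s t u) := by simp [m3, IsLinear]

@[simp] theorem isTK_leaf : IsTK leaf := by simp [leaf, IsTK]
@[simp] theorem isTK_m1 (t) : IsTK (m1 t) ↔ IsTK t := by simp [m1, IsTK]
@[simp] theorem isTK_m2 (s t) : IsTK (m2 s t) ↔ IsTK s ∧ IsTK t := by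
  simp [m2, IsTK, Fin.forall_fin_two]
@[simp] theorem isTK_m3 (s t u) : IsTK (m3 s t u) ↔ IsTK s ∧ IsTK t ∧ IsTK u := by
  simp [m3, IsTK, Fin.forall_fin_succ]
@[simp] theorem isTK_fat (t) : IsTK (fat t) ↔ ¬ IsLinear t ∧ IsTK t := by simp [IsTK]

@[simp] theorem recolor_leaf : recolor leaf = leaf := by
  simp only [leaf, recolor]; congr; ext i; exact i.elim0
@[simp] theorem recolor_m1 (t) : recolor (m1 t) = m1 (recolor t) := by
  simp only [m1, recolor]; congr; ext i; fin_cases i; rfl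
@[simp] theorem recolor_m2 (s t) : recolor (m2 s t) = m2 (recolor s) (recolor t) := by
  simp only [m2, recolor]; congr; ext i; fin_cases i <;> rfl
@[simp] theorem recolor_m3 (s t u) :
    recolor (m3 s t u) = m3 (recolor s) (recolor t) (recolor u) := by
  simp only [m3, recolor]; congr; ext i; fin_cases i <;> rfl
theorem recolor_fat_of_isLinear {t} (h : IsLinear t) : recolor (fat t) = m1 (recolor t) := by
  simp [recolor, h, m1]
theorem recolor_fat_of_not_isLinear {t} (h : ¬ IsLinear t) :
    recolor (fat t) = fat (recolor t) := by
  simp [recolor, h]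

/-- The index of the tree to which `tau i` is recoloured. -/
def recolorIdx : Fin 21 → Fin 21 :=
  ![0, 1, 1, 3, 4, 4, 4, 4, 8, 9, 9, 11, 12, 13, 13, 13, 13, 13, 13, 13, 13]

theorem recolor_tau (i : Fin 21) : recolor (tau i) = tau (recolorIdx i) := by
  fin_cases i <;> simp [tau, recolorIdx, recolor_fat_of_isLinear, recolor_fat_of_not_isLinear]

theorem isTK_tau_iff (i : Fin 21) :
    IsTK (tau i) ↔ i ∈ ({0, 1, 3, 4, 8, 9, 11, 12, 13} : Finset (Fin 21)) := by
  fin_cases i <;> simp [tau]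

end TWTree

/-! ### The K-conditions -/

/-- Recolouring maps the list `tau` into itself up to equality, not merely isomorphism, and the list
has no repetitions. The sum therefore runs over a fibre of the index map `recolorIdx`. -/
theorem mergedCoeff_eq (a : Fin 21 → ℝ) (j : Fin 21) :
    mergedCoeff a j = ∑ i, if TWTree.recolorIdx i = j then a i else 0 := by
  classical
  rw [mergedCoeff, Finset.sum_filter]
  refine Finset.sum_congr rfl fun i _ => ?_
  rw [TWTree.recolor_tau]
  have : TWTree.Iso (TWTree.tau (TWTree.recolorIdx i)) (TWTree.tau j) ↔
      TWTree.recolorIdx i = j :=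
    ⟨TWTree.tau_injective, fun h => h ▸ TWTree.Iso.refl _⟩
  simp only [this]

theorem sum_fin_21 {M : Type*} [AddCommMonoid M] (g : Fin 21 → M) :
    ∑ i, g i = g 0 + (g 1 + g 2) + (g 3 + g 4 + g 5 + g 6 + g 7) +
      (g 8 + g 9 + g 10 + g 11 + g 12 + g 13 + g 14 + g 15 + g 16 + g 17 + g 18 + g 19 + g 20) := by
  simp only [Fin.sum_univ_castSucc, Fin.sum_univ_zero, zero_add, ← add_assoc]
  rfl

theorem mergedCoeff_eq_vec (a : Fin 21 → ℝ) (j : Fin 21) :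
    mergedCoeff a j = (![a 0, a 1 + a 2, 0, a 3, a 4 + a 5 + a 6 + a 7, 0, 0, 0, a 8, a 9 + a 10, 0,
      a 11, a 12, a 13 + a 14 + a 15 + a 16 + a 17 + a 18 + a 19 + a 20, 0, 0, 0, 0, 0, 0, 0] :
      Fin 21 → ℝ) j := by
  rw [mergedCoeff_eq, sum_fin_21]
  fin_cases j <;> simp +decide

theorem kCondition_exp4k {j : Fin 21} (hj : TWTree.IsTK (TWTree.tau j)) :
    KCondition exp4kCoeff j := by
  rw [TWTree.isTK_tau_iff] at hj
  rw [KCondition, mergedCoeff_eq_vec, mergedCoeff_eq_vec]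
  fin_cases hj <;> simp [exp4kCoeff, exactCoeff] <;> norm_num

/-- This also serves erow4sp, whose coefficient vector has the same entries. -/
theorem kCondition_exp4sp_iff {j : Fin 21} (hj : TWTree.IsTK (TWTree.tau j)) :
    KCondition exp4spCoeff j ↔ j ≠ 11 ∧ j ≠ 12 := by
  rw [TWTree.isTK_tau_iff] at hj
  rw [KCondition, mergedCoeff_eq_vec, mergedCoeff_eq_vec]
  fin_cases hj <;> simp [exp4spCoeff, exactCoeff]

theorem kCondition_erow4k_iff {j : Fin 21} (hj : TWTree.IsTK (TWTree.tau j)) :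
    KCondition erow4kCoeff j ↔ j ≠ 11 ∧ j ≠ 12 := by
  rw [TWTree.isTK_tau_iff] at hj
  rw [KCondition, mergedCoeff_eq_vec, mergedCoeff_eq_vec]
  fin_cases hj <;> simp [erow4kCoeff, exactCoeff] <;> norm_num

/-! ### Taylor's formula of third order -/

section Taylor

theorem two_le_infty : (2 : WithTop ℕ∞) ≤ ∞ := by
  have : ((2 : ℕ) : WithTop ℕ∞) ≤ ∞ := by
    rw [← WithTop.coe_natCast]
    exact WithTop.coe_le_coe.2 le_top
  exact this

variable {E F : Type*} [NormedAddCommGroup E] [NormedSpace ℝ E] [NormedAddCommGroup F]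
  [NormedSpace ℝ F]

/-- A function that vanishes at the origin gains one order over its derivative. -/
theorem isBigO_pow_succ_of_hasFDerivAt {R : E → F} {R' : E → E →L[ℝ] F} {n : ℕ} (h0 : R 0 = 0)
    (hR : ∀ v, HasFDerivAt R (R' v) v) (hR' : R' =O[𝓝 0] fun v => ‖v‖ ^ n) :
    R =O[𝓝 0] fun v => ‖v‖ ^ (n + 1) := by
  obtain ⟨C, hC⟩ := hR'.bound
  obtain ⟨ε, hε, hb⟩ := Metric.eventually_nhds_iff_ball.1 hC
  refine IsBigO.of_bound C ?_
  filter_upwards [Metric.ball_mem_nhds (0 : E) hε] with v hv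
  have hv' : ‖v‖ < ε := by simpa using hv
  have key := (convex_closedBall (0 : E) ‖v‖).norm_image_sub_le_of_norm_hasFDerivWithin_le
    (f := R) (f' := R') (C := C * ‖v‖ ^ n) (x := 0) (y := v)
    (fun x _ => (hR x).hasFDerivWithinAt) (fun x hx => ?_) (by simp) (by simp)
  · simpa [h0, pow_succ, mul_assoc] using key
  · have hx' : ‖x‖ ≤ ‖v‖ := by simpa using hx
    have h1 := hb x (by simpa using hx'.trans_lt hv')
    -- The constant supplied by the `O`-bound may be negative; evaluated at `v` itself, the bound
    -- then forces the power to vanish.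
    have hC0 : 0 ≤ C ∨ ‖v‖ ^ n = 0 := by
      by_contra! hcon
      have h2 := hb v hv
      rw [norm_pow, norm_norm] at h2
      have : 0 < ‖v‖ ^ n := lt_of_le_of_ne (by positivity) (Ne.symm hcon.2)
      nlinarith [norm_nonneg (R' v)]
    rw [norm_pow, norm_norm] at h1
    rcases hC0 with hC0 | hC0
    · exact h1.trans (by gcongr)
    · have : ‖x‖ ^ n = 0 := le_antisymm (hC0 ▸ by gcongr) (by positivity)
      rwa [hC0, ← this]

/-- The second derivative as a bilinear map. -/
noncomputable def secondDeriv (f : E → F) (y : E) : E →L[ℝ] E →L[ℝ] F :=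
  fderiv ℝ (fderiv ℝ f) y

/-- The third derivative as a trilinear map. -/
noncomputable def thirdDeriv (f : E → F) (y : E) : E →L[ℝ] E →L[ℝ] E →L[ℝ] F :=
  fderiv ℝ (fderiv ℝ (fderiv ℝ f)) y

theorem iteratedFDeriv_two_vec (f : E → F) (y a b : E) :
    iteratedFDeriv ℝ 2 f y ![a, b] = secondDeriv f y a b := by
  simp [iteratedFDeriv_two_apply, secondDeriv]

theorem iteratedFDeriv_three_vec (f : E → F) (y a b c : E) :
    iteratedFDeriv ℝ 3 f y ![a, b, c] = thirdDeriv f y a b c := by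
  rw [iteratedFDeriv_succ_apply_right, iteratedFDeriv_two_apply]
  rfl

variable {f : E → F} (hf : ContDiff ℝ ∞ f) (y : E)
include hf

theorem secondDeriv_symm (a b : E) : secondDeriv f y a b = secondDeriv f y b a :=
  (hf.contDiffAt.isSymmSndFDerivAt (by simpa using two_le_infty)) a b

theorem contDiff_fderiv : ContDiff ℝ ∞ (fderiv ℝ f) := hf.fderiv_right (by simp)

theorem hasFDerivAt_fderiv : HasFDerivAt (fderiv ℝ f) (secondDeriv f y) y :=
  ((contDiff_fderiv hf).differentiable (by simp) y).hasFDerivAt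

theorem hasFDerivAt_secondDeriv : HasFDerivAt (secondDeriv f) (thirdDeriv f y) y :=
  hasFDerivAt_fderiv (contDiff_fderiv hf) y

theorem thirdDeriv_symm_left (a b : E) : thirdDeriv f y a b = thirdDeriv f y b a :=
  secondDeriv_symm (contDiff_fderiv hf) y a b

/-- The symmetry of the second derivative holds at every base point and may be differentiated in the
base point. -/
theorem thirdDeriv_symm_right (a b c : E) : thirdDeriv f y a b c = thirdDeriv f y a c b := by
  have h (b c : E) : HasFDerivAt (fun x => secondDeriv f x b c)
      (((thirdDeriv f y).flip b).flip c) y := by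
    have := ((hasFDerivAt_secondDeriv hf y).clm_apply (hasFDerivAt_const b y)).clm_apply
      (hasFDerivAt_const c y)
    convert this using 1
    ext; simp
  have h1 := h b c
  simp only [secondDeriv_symm hf _ b c] at h1
  simpa using congrArg (fun L => L a) (h1.unique (h c b))

/-- Taylor's formula of third order. -/
theorem taylor_three_isBigO :
    (fun v => f (y + v) - f y - fderiv ℝ f y v - (1 / 2 : ℝ) • secondDeriv f y v v
      - (1 / 6 : ℝ) • thirdDeriv f y v v v) =O[𝓝 0] fun v => ‖v‖ ^ 4 := by
  have hadd (v : E) : HasFDerivAt (fun v => y + v) (ContinuousLinearMap.id ℝ E) v :=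
    (hasFDerivAt_id v).const_add y
  -- Differentiability of the third derivative gives a first-order remainder, which is then
  -- integrated three times. The symmetries of the derivatives make each Taylor polynomial
  -- differentiate to the preceding one.
  have h3 : (fun v => thirdDeriv f (y + v) - thirdDeriv f y) =O[𝓝 0] fun v => ‖v‖ ^ 1 := by
    have hd : HasFDerivAt (thirdDeriv f) (thirdDeriv (fderiv ℝ f) y) y :=
      hasFDerivAt_secondDeriv (contDiff_fderiv hf) y
    have h := hd.isBigO_sub
    have ht : Tendsto (fun v : E => y + v) (𝓝 0) (𝓝 y) := by
      have : Continuous fun v : E => y + v := by fun_prop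
      simpa using this.tendsto 0
    simpa [Function.comp_def] using (h.comp_tendsto ht).norm_right
  have h2 : (fun v => secondDeriv f (y + v) - secondDeriv f y - thirdDeriv f y v)
      =O[𝓝 0] fun v => ‖v‖ ^ 2 := by
    refine isBigO_pow_succ_of_hasFDerivAt (by simp) (fun v => ?_) h3
    exact ((((hasFDerivAt_secondDeriv hf (y + v)).comp v (hadd v)).sub_const _).sub
      (thirdDeriv f y).hasFDerivAt).congr_fderiv (by ext; simp)
  have h1 : (fun v => fderiv ℝ f (y + v) - fderiv ℝ f y - secondDeriv f y v
      - (1 / 2 : ℝ) • thirdDeriv f y v v) =O[𝓝 0] fun v => ‖v‖ ^ 3 := by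
    refine isBigO_pow_succ_of_hasFDerivAt (by simp) (fun v => ?_) h2
    refine (((((hasFDerivAt_fderiv hf (y + v)).comp v (hadd v)).sub_const _).sub
      (secondDeriv f y).hasFDerivAt).sub
      (((thirdDeriv f y).hasFDerivAt.clm_apply (hasFDerivAt_id v)).const_smul
        (1 / 2 : ℝ))).congr_fderiv ?_
    ext u w
    simp [thirdDeriv_symm_left hf y u v]
    module
  refine isBigO_pow_succ_of_hasFDerivAt (by simp) (fun v => ?_) h1
  refine ((((((hf.differentiable (by simp) (y + v)).hasFDerivAt.comp v (hadd v)).sub_const _).sub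
    (fderiv ℝ f y).hasFDerivAt).sub
    (((secondDeriv f y).hasFDerivAt.clm_apply (hasFDerivAt_id v)).const_smul (1 / 2 : ℝ))).sub
    ((((thirdDeriv f y).hasFDerivAt.clm_apply (hasFDerivAt_id v)).clm_apply
      (hasFDerivAt_id v)).const_smul (1 / 6 : ℝ))).congr_fderiv ?_
  ext u
  simp [thirdDeriv_symm_left hf y u v, thirdDeriv_symm_right hf y v u v, secondDeriv_symm hf y u v]
  module

end Taylor

/-! ### Truncated B-series and the calculus of their coefficients -/

section Expansions

variable {E : Type*} [NormedAddCommGroup E] [NormedSpace ℝ E]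

/-- The elementary differentials of the trees `tau i`, divided by the symmetry coefficients. -/
noncomputable def scaledDiff (A : E →L[ℝ] E) (f : E → E) (y : E) : Fin 21 → E :=
  let J := fderiv ℝ f y
  let e := f y
  let q := (1 / 2 : ℝ) • secondDeriv f y e e
  ![e, J e, A e,
    q, J (J e), J (A e), A (J e), A (A e),
    (1 / 6 : ℝ) • thirdDeriv f y e e e, secondDeriv f y e (J e), secondDeriv f y e (A e),
    J q, A q,
    J (J (J e)), J (J (A e)), J (A (J e)), J (A (A e)),
    A (J (J e)), A (J (A e)), A (A (J e)), A (A (A e))]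

open TWTree in
theorem elemDiff_leaf (A : E →L[ℝ] E) (f : E → E) (y : E) : elemDiff A f y leaf = f y := by
  simp [leaf, elemDiff]

open TWTree in
theorem elemDiff_m1 (A : E →L[ℝ] E) (f : E → E) (y : E) (t : TWTree) :
    elemDiff A f y (m1 t) = fderiv ℝ f y (elemDiff A f y t) := by
  simp [m1, elemDiff]

open TWTree in
theorem elemDiff_m2 (A : E →L[ℝ] E) (f : E → E) (y : E) (s t : TWTree) :
    elemDiff A f y (m2 s t) = secondDeriv f y (elemDiff A f y s) (elemDiff A f y t) := by
  rw [← iteratedFDeriv_two_vec, m2, elemDiff]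
  congr 1
  ext i; fin_cases i <;> rfl

open TWTree in
theorem elemDiff_m3 (A : E →L[ℝ] E) (f : E → E) (y : E) (s t u : TWTree) :
    elemDiff A f y (m3 s t u) =
      thirdDeriv f y (elemDiff A f y s) (elemDiff A f y t) (elemDiff A f y u) := by
  rw [← iteratedFDeriv_three_vec, m3, elemDiff]
  congr 1
  ext i; fin_cases i <;> rfl

open TWTree in
theorem elemDiff_fat (A : E →L[ℝ] E) (f : E → E) (y : E) (t : TWTree) :
    elemDiff A f y (fat t) = A (elemDiff A f y t) := by
  simp [elemDiff]

open TWTree in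
theorem inv_symmetry_smul_elemDiff (A : E →L[ℝ] E) (f : E → E) (y : E) (i : Fin 21) :
    ((tau i).symmetry : ℝ)⁻¹ • elemDiff A f y (tau i) = scaledDiff A f y i := by
  rw [symmetry_tau]
  fin_cases i <;>
    simp [tau, scaledDiff, elemDiff_leaf, elemDiff_m1, elemDiff_m2, elemDiff_m3, elemDiff_fat]

/-- The terms of a B-series at the trees of order one. -/
noncomputable def term₀ (a : Fin 21 → ℝ) (T : Fin 21 → E) : E := a 0 • T 0

/-- The terms of a B-series at the trees of order two. -/
noncomputable def term₁ (a : Fin 21 → ℝ) (T : Fin 21 → E) : E := a 1 • T 1 + a 2 • T 2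

/-- The terms of a B-series at the trees of order three. -/
noncomputable def term₂ (a : Fin 21 → ℝ) (T : Fin 21 → E) : E :=
  a 3 • T 3 + a 4 • T 4 + a 5 • T 5 + a 6 • T 6 + a 7 • T 7

/-- The terms of a B-series at the trees of order four. -/
noncomputable def term₃ (a : Fin 21 → ℝ) (T : Fin 21 → E) : E :=
  a 8 • T 8 + a 9 • T 9 + a 10 • T 10 + a 11 • T 11 + a 12 • T 12 + a 13 • T 13 + a 14 • T 14 +
    a 15 • T 15 + a 16 • T 16 + a 17 • T 17 + a 18 • T 18 + a 19 • T 19 + a 20 • T 20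

/-- The sum of the terms of a B-series, divided by the step size. -/
noncomputable def expansion (a : Fin 21 → ℝ) (T : Fin 21 → E) (h : ℝ) : E :=
  term₀ a T + h • term₁ a T + h ^ 2 • term₂ a T + h ^ 3 • term₃ a T

theorem bSeries4_eq_sum {N : ℕ} (a : Fin 21 → ℝ) (A : Rn N →L[ℝ] Rn N) (f : Rn N → Rn N)
    (y : Rn N) (h : ℝ) :
    bSeries4 a A f y h = y + ∑ i, (a i * h ^ TWTree.ord i) • scaledDiff A f y i := by
  rw [bSeries4]
  refine congrArg _ (Finset.sum_congr rfl fun i _ => ?_)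
  rw [← inv_symmetry_smul_elemDiff, TWTree.order_tau, smul_smul, div_eq_mul_inv, mul_assoc]

theorem bSeries4_eq {N : ℕ} (a : Fin 21 → ℝ) (A : Rn N →L[ℝ] Rn N) (f : Rn N → Rn N)
    (y : Rn N) (h : ℝ) :
    bSeries4 a A f y h = y + h • expansion a (scaledDiff A f y) h := by
  rw [bSeries4_eq_sum, sum_fin_21]
  generalize scaledDiff A f y = T
  simp [TWTree.ord, expansion, term₀, term₁, term₂, term₃]
  module

theorem expansion_add (a b : Fin 21 → ℝ) (T : Fin 21 → E) (h : ℝ) :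
    expansion (a + b) T h = expansion a T h + expansion b T h := by
  simp only [expansion, term₀, term₁, term₂, term₃, Pi.add_apply]
  module

theorem expansion_smul (c : ℝ) (a : Fin 21 → ℝ) (T : Fin 21 → E) (h : ℝ) :
    expansion (c • a) T h = c • expansion a T h := by
  simp only [expansion, term₀, term₁, term₂, term₃, Pi.smul_apply, smul_eq_mul]
  module

theorem expansion_sub (a b : Fin 21 → ℝ) (T : Fin 21 → E) (h : ℝ) :
    expansion (a - b) T h = expansion a T h - expansion b T h := by
  rw [sub_eq_add_neg, ← neg_one_smul ℝ b, expansion_add, expansion_smul]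
  module

/-- `g` agrees up to order `n` with the B-series with coefficients `a`, divided by the step
size. -/
def HasExpansion (T : Fin 21 → E) (n : ℕ) (g : ℝ → E) (a : Fin 21 → ℝ) : Prop :=
  (fun h => g h - expansion a T h) =O[𝓝[>] (0 : ℝ)] fun h => h ^ n

theorem isBigO_pow_of_le {m n : ℕ} (h : m ≤ n) :
    (fun h : ℝ => h ^ n) =O[𝓝[>] (0 : ℝ)] fun h => h ^ m := by
  refine IsBigO.of_bound 1 ?_
  filter_upwards [Ioo_mem_nhdsGT (zero_lt_one (α := ℝ))] with x hx
  rw [one_mul, norm_pow, norm_pow]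
  exact pow_le_pow_of_le_one (norm_nonneg _)
    (by rw [Real.norm_of_nonneg hx.1.le]; exact hx.2.le) h

omit [NormedSpace ℝ E] in
theorem Asymptotics.IsBigO.pow_mono {g : ℝ → E} {m n : ℕ} (hg : g =O[𝓝[>] (0 : ℝ)] fun h => h ^ n)
    (h : m ≤ n) : g =O[𝓝[>] (0 : ℝ)] fun h => h ^ m :=
  hg.trans (isBigO_pow_of_le h)

theorem Asymptotics.IsBigO.pow_smul {g : ℝ → E} {n : ℕ} (hg : g =O[𝓝[>] (0 : ℝ)] fun h => h ^ n) (k : ℕ) :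
    (fun h => h ^ k • g h) =O[𝓝[>] (0 : ℝ)] fun h => h ^ (k + n) := by
  simpa [pow_add] using (isBigO_refl (fun h : ℝ => h ^ k) (𝓝[>] 0)).smul hg

theorem isBigO_pow_smul_const (k : ℕ) (v : E) :
    (fun h : ℝ => h ^ k • v) =O[𝓝[>] (0 : ℝ)] fun h => h ^ k := by
  simpa using IsBigO.pow_smul (n := 0) (g := fun _ => v)
    (by simpa using isBigO_const_const v (one_ne_zero (α := ℝ)) _) k

theorem isBigO_const_pow_zero (v : E) :
    (fun _ : ℝ => v) =O[𝓝[>] (0 : ℝ)] fun h : ℝ => h ^ 0 := by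
  simpa using isBigO_pow_smul_const 0 v

theorem isBigO_bilinear {F G : Type*} [NormedAddCommGroup F] [NormedSpace ℝ F]
    [NormedAddCommGroup G] [NormedSpace ℝ G] (B : E →L[ℝ] F →L[ℝ] G) {u : ℝ → E} {v : ℝ → F}
    {m n : ℕ} (hu : u =O[𝓝[>] (0 : ℝ)] fun h => h ^ m) (hv : v =O[𝓝[>] (0 : ℝ)] fun h => h ^ n) :
    (fun h => B (u h) (v h)) =O[𝓝[>] (0 : ℝ)] fun h => h ^ (m + n) := by
  have h1 : (fun h => B (u h) (v h)) =O[𝓝[>] (0 : ℝ)] fun h => ‖u h‖ * ‖v h‖ :=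
    IsBigO.of_bound ‖B‖ (Eventually.of_forall fun h => by
      simpa [mul_assoc] using B.le_opNorm₂ (u h) (v h))
  refine h1.trans ?_
  simpa [pow_add] using hu.norm_left.mul hv.norm_left

namespace HasExpansion

variable {T : Fin 21 → E} {n : ℕ} {g g' : ℝ → E} {a a' : Fin 21 → ℝ}

theorem mono (hg : HasExpansion T n g a) {m : ℕ} (h : m ≤ n) : HasExpansion T m g a :=
  IsBigO.pow_mono hg h

theorem add (hg : HasExpansion T n g a) (hg' : HasExpansion T n g' a') :
    HasExpansion T n (fun h => g h + g' h) (a + a') := by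
  refine (IsBigO.add hg hg').congr_left fun h => ?_
  rw [expansion_add]
  module

theorem sub (hg : HasExpansion T n g a) (hg' : HasExpansion T n g' a') :
    HasExpansion T n (fun h => g h - g' h) (a - a') := by
  refine (IsBigO.sub hg hg').congr_left fun h => ?_
  rw [expansion_sub]
  module

theorem const_smul (hg : HasExpansion T n g a) (c : ℝ) :
    HasExpansion T n (fun h => c • g h) (c • a) := by
  refine (IsBigO.const_smul_left hg c).congr_left fun h => ?_
  rw [Pi.smul_apply, expansion_smul, smul_sub]

theorem sub_term₀ (hg : HasExpansion T n g a) :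
    (fun h => g h - term₀ a T) =O[𝓝[>] (0 : ℝ)] fun h => h ^ min n 1 := by
  have h1 := (IsBigO.pow_mono hg (min_le_left n 1)).add
    (((isBigO_pow_smul_const 1 (term₁ a T)).add ((isBigO_pow_smul_const 2 (term₂ a T)).pow_mono
      (by norm_num) |>.add ((isBigO_pow_smul_const 3 (term₃ a T)).pow_mono
        (by norm_num)))).pow_mono (min_le_right n 1))
  refine h1.congr_left fun h => ?_
  rw [expansion]
  module

theorem sub_term₀_term₁ (hg : HasExpansion T n g a) :
    (fun h => g h - (term₀ a T + h • term₁ a T)) =O[𝓝[>] (0 : ℝ)] fun h => h ^ min n 2 := by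
  have h1 := (IsBigO.pow_mono hg (min_le_left n 2)).add
    (((isBigO_pow_smul_const 2 (term₂ a T)).add ((isBigO_pow_smul_const 3 (term₃ a T)).pow_mono
        (by norm_num))).pow_mono (min_le_right n 2))
  refine h1.congr_left fun h => ?_
  rw [expansion]
  module

theorem isBigO_one (hg : HasExpansion T n g a) :
    g =O[𝓝[>] (0 : ℝ)] fun h => h ^ 0 := by
  refine (((hg.sub_term₀).pow_mono (Nat.zero_le _)).add
    (isBigO_const_pow_zero (term₀ a T))).congr_left fun h => ?_
  module

/-- At accuracy zero an expansion carries no information beyond boundedness, so the zero vector will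
do. This starts the recursion for the `φ`-functions. -/
theorem of_isBigO_one (hg : g =O[𝓝[>] (0 : ℝ)] fun h => h ^ 0) : HasExpansion T 0 g 0 := by
  refine hg.congr_left fun h => ?_
  simp [expansion, term₀, term₁, term₂, term₃]

/-- The coefficients of `h A g(h)`. -/
def fatShift (a : Fin 21 → ℝ) : Fin 21 → ℝ :=
  ![0, 0, a 0, 0, 0, 0, a 1, a 2, 0, 0, 0, 0, a 3, 0, 0, 0, 0, a 4, a 5, a 6, a 7]

/-- The coefficients of `h f'(y) g(h)`. -/
def meagreShift (a : Fin 21 → ℝ) : Fin 21 → ℝ :=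
  ![0, a 0, 0, 0, a 1, a 2, 0, 0, 0, 0, 0, a 3, 0, a 4, a 5, a 6, a 7, 0, 0, 0, 0]

/-- The coefficients of `f(y + h g(h))`. -/
def compShift (a : Fin 21 → ℝ) : Fin 21 → ℝ :=
  ![1, a 0, 0, a 0 ^ 2, a 1, a 2, 0, 0, a 0 ^ 3, a 0 * a 1, a 0 * a 2, a 3, 0, a 4, a 5, a 6, a 7,
    0, 0, 0, 0]

/-- If a linear map acts on the elementary differentials of order at most three through an index
shift, multiplication by `h` times this map raises the order of an expansion by one. -/
theorem smul_clm {L : E →L[ℝ] E} {b : Fin 21 → ℝ} (h0 : term₀ b T = 0)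
    (h1 : term₁ b T = L (term₀ a T)) (h2 : term₂ b T = L (term₁ a T))
    (h3 : term₃ b T = L (term₂ a T)) (hg : HasExpansion T n g a) {k : ℕ} (hk : k ≤ n + 1)
    (hk' : k ≤ 4) : HasExpansion T k (fun h => h • L (g h)) b := by
  have e1 : (fun h => h ^ 1 • L (g h - expansion a T h)) =O[𝓝[>] (0 : ℝ)] fun h => h ^ k :=
    (IsBigO.pow_smul ((L.isBigO_comp _ _).trans hg) 1).pow_mono (by omega)
  have e2 := (isBigO_pow_smul_const 4 (L (term₃ a T))).pow_mono hk'
  refine (e1.add e2).congr_left fun h => ?_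
  simp only [expansion, h0, h1, h2, h3, map_sub, map_add, map_smul]
  module

variable {A : E →L[ℝ] E} {f : E → E} {y : E}

theorem smul_fat (hg : HasExpansion (scaledDiff A f y) n g a) {k : ℕ} (hk : k ≤ n + 1)
    (hk' : k ≤ 4) : HasExpansion (scaledDiff A f y) k (fun h => h • A (g h)) (fatShift a) := by
  refine smul_clm ?_ ?_ ?_ ?_ hg hk hk' <;>
    simp [term₀, term₁, term₂, term₃, fatShift, scaledDiff]

theorem smul_fderiv (hg : HasExpansion (scaledDiff A f y) n g a) {k : ℕ} (hk : k ≤ n + 1)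
    (hk' : k ≤ 4) :
    HasExpansion (scaledDiff A f y) k (fun h => h • fderiv ℝ f y (g h)) (meagreShift a) := by
  refine smul_clm ?_ ?_ ?_ ?_ hg hk hk' <;>
    simp [term₀, term₁, term₂, term₃, meagreShift, scaledDiff]

theorem expansion_compShift (h : ℝ) :
    expansion (compShift a) (scaledDiff A f y) h =
      f y + expansion (meagreShift a) (scaledDiff A f y) h
        + h ^ 2 • (1 / 2 : ℝ) • (secondDeriv f y (term₀ a (scaledDiff A f y))
            (term₀ a (scaledDiff A f y)) + (2 * h) • secondDeriv f y (term₀ a (scaledDiff A f y))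
            (term₁ a (scaledDiff A f y)))
        + h ^ 3 • (1 / 6 : ℝ) • thirdDeriv f y (term₀ a (scaledDiff A f y))
            (term₀ a (scaledDiff A f y)) (term₀ a (scaledDiff A f y)) := by
  simp [expansion, term₀, term₁, term₂, term₃, meagreShift, compShift, scaledDiff]
  module

/-- Taylor's formula at `v = h g(h)`. The factor `h` in front of `g` makes the result one order more
accurate than `g`, as the bootstrap for the exact solution requires. Up to `h ^ 4` the cubic term
only sees the constant part of `g`, and the quadratic term only its constant and linear parts. -/
theorem comp (hf : ContDiff ℝ ∞ f) (hg : HasExpansion (scaledDiff A f y) n g a) {k : ℕ}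
    (hk : k ≤ n + 1) (hk' : k ≤ 4) :
    HasExpansion (scaledDiff A f y) k (fun h => f (y + h • g h)) (compShift a) := by
  set T := scaledDiff A f y with hT
  set D₂ := secondDeriv f y with hD₂
  set D₃ := thirdDeriv f y with hD₃
  set c₀ := term₀ a T with hc₀
  set c₁ := term₁ a T with hc₁
  have hb := hg.isBigO_one
  have hv : (fun h => h • g h) =O[𝓝[>] (0 : ℝ)] fun h => h ^ 1 := by
    simpa using IsBigO.pow_smul hb 1
  have htend : Tendsto (fun h => h • g h) (𝓝[>] (0 : ℝ)) (𝓝 0) := by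
    refine hv.trans_tendsto ?_
    exact (tendsto_id.mono_left nhdsWithin_le_nhds : Tendsto id (𝓝[>] (0 : ℝ)) (𝓝 0)).congr
      fun h => (pow_one h).symm
  have e1 := ((taylor_three_isBigO hf y).comp_tendsto htend).trans
    (by simpa [Function.comp_def] using hv.norm_left.pow 4 :
      ((fun v : E => ‖v‖ ^ 4) ∘ fun h => h • g h) =O[𝓝[>] (0 : ℝ)] fun h => h ^ 4)
  replace e1 := e1.pow_mono hk'
  have e2 : (fun h => h • fderiv ℝ f y (g h) - expansion (meagreShift a) T h)
      =O[𝓝[>] (0 : ℝ)] fun h => h ^ k := hg.smul_fderiv hk hk'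
  have hr := hg.sub_term₀_term₁
  have hs := hg.sub_term₀
  have hlin : (fun h => c₀ + h • c₁) =O[𝓝[>] (0 : ℝ)] fun h => h ^ 0 :=
    (isBigO_const_pow_zero c₀).add
      ((by simpa using isBigO_pow_smul_const 1 c₁ :
        (fun h : ℝ => h • c₁) =O[𝓝[>] (0 : ℝ)] fun h => h ^ 1).pow_mono (Nat.zero_le _))
  -- By bilinearity and symmetry, the bracket is `D₂ g g` minus the retained terms `D₂ c₀ c₀ + 2 h
  -- D₂ c₀ c₁`.
  have e3 : (fun h => h ^ 2 • (1 / 2 : ℝ) • (D₂ (g h - (c₀ + h • c₁)) (g h)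
      + D₂ (c₀ + h • c₁) (g h - (c₀ + h • c₁)) + h ^ 2 • D₂ c₁ c₁))
      =O[𝓝[>] (0 : ℝ)] fun h => h ^ k := by
    refine IsBigO.pow_mono (n := 2 + min n 2) (IsBigO.pow_smul ?_ 2) (by omega)
    refine IsBigO.const_smul_left ?_ _
    refine ((isBigO_bilinear D₂ hr hb).add ((isBigO_bilinear D₂ hlin hr).congr_right
      fun h => by rw [zero_add, add_zero])).add ?_
    exact (isBigO_pow_smul_const 2 _).pow_mono (by omega)
  -- Replacing the arguments by `c₀` one at a time, the bracket telescopes to `D₃ g g g - D₃ c₀ c₀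
  -- c₀`.
  have e4 : (fun h => h ^ 3 • (1 / 6 : ℝ) • (D₃ (g h - c₀) (g h) (g h)
      + D₃ c₀ (g h - c₀) (g h) + D₃ c₀ c₀ (g h - c₀)))
      =O[𝓝[>] (0 : ℝ)] fun h => h ^ k := by
    refine IsBigO.pow_mono (n := 3 + min n 1) (IsBigO.pow_smul ?_ 3) (by omega)
    refine IsBigO.const_smul_left ?_ _
    have h1 {u : ℝ → E →L[ℝ] E} {m : ℕ} (hu : u =O[𝓝[>] (0 : ℝ)] fun h => h ^ m) :
        (fun h => u h (g h)) =O[𝓝[>] (0 : ℝ)] fun h => h ^ m :=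
      isBigO_bilinear (ContinuousLinearMap.id ℝ (E →L[ℝ] E)) hu hb
    refine ((h1 (isBigO_bilinear D₃ hs hb)).add (h1 ((D₃ c₀).isBigO_comp _ _ |>.trans hs))).add ?_
    exact (D₃ c₀ c₀).isBigO_comp _ _ |>.trans hs
  refine (((e1.add e2).add e3).add e4).congr_left fun h => ?_
  have symm (a b : E) : D₂ a b = D₂ b a := secondDeriv_symm hf y a b
  simp only [Function.comp_apply]
  rw [expansion_compShift, ← hT, ← hc₀, ← hc₁, ← hD₂, ← hD₃]
  simp only [map_sub, map_add, map_smul, sub_apply, add_apply, smul_apply, symm c₁ c₀]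
  module

end HasExpansion

end Expansions

/-! ### Bounds and recurrence for the `φ`-functions -/

section Phi

variable {n : ℕ}

/-- Comparison with the exponential series of `H`, uniform in `t`; it yields both convergence and a
bound that survives `h → 0`. -/
theorem norm_phi_term_le (k i : ℕ) {t : ℝ} (ht : |t| ≤ 1) (H : Rn n →L[ℝ] Rn n) :
    ‖((k + i)! : ℝ)⁻¹ • (t • H) ^ i‖ ≤ ‖((i ! : ℝ)⁻¹) • H ^ i‖ := by
  rw [smul_pow, norm_smul, norm_smul, norm_smul]
  have h1 : ‖((k + i)! : ℝ)⁻¹‖ ≤ ‖(i ! : ℝ)⁻¹‖ := by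
    rw [norm_inv, norm_inv, Real.norm_natCast, Real.norm_natCast]
    gcongr
    exact Nat.le_add_left i k
  have h2 : ‖t ^ i‖ ≤ 1 := by
    rw [norm_pow]
    exact pow_le_one₀ (norm_nonneg _) ht
  calc _ ≤ ‖(i ! : ℝ)⁻¹‖ * (1 * ‖H ^ i‖) := by gcongr
    _ = _ := by rw [one_mul]

theorem summable_norm_phi (k : ℕ) (Z : Rn n →L[ℝ] Rn n) :
    Summable fun i : ℕ => ‖((k + i)! : ℝ)⁻¹ • Z ^ i‖ :=
  (NormedSpace.norm_expSeries_summable' (𝕂 := ℝ) Z).of_nonneg_of_le (fun _ => norm_nonneg _)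
    fun i => by simpa using norm_phi_term_le k i (t := 1) (by simp) Z

theorem phi_eq (k : ℕ) (Z : Rn n →L[ℝ] Rn n) :
    phi k Z = (k ! : ℝ)⁻¹ • 1 + Z * phi (k + 1) Z := by
  have hs := (summable_norm_phi k Z).of_norm
  have hs' := (summable_norm_phi (k + 1) Z).of_norm
  rw [phi, hs.tsum_eq_zero_add, phi, ← hs'.tsum_mul_left]
  refine congrArg₂ _ (by simp) ?_
  refine tsum_congr fun i => ?_
  rw [mul_smul_comm, ← pow_succ', add_assoc, add_comm 1 i]

theorem norm_phi_smul_le (k : ℕ) {t : ℝ} (ht : |t| ≤ 1) (H : Rn n →L[ℝ] Rn n) :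
    ‖phi k (t • H)‖ ≤ ∑' i : ℕ, ‖((i ! : ℝ)⁻¹) • H ^ i‖ := by
  refine (norm_tsum_le_tsum_norm (summable_norm_phi k _)).trans ?_
  exact (summable_norm_phi k _).tsum_le_tsum (fun i => norm_phi_term_le k i ht H)
    (NormedSpace.norm_expSeries_summable' (𝕂 := ℝ) H)

end Phi

/-! ### The projected operators `Φ_k(c)` -/

section PhiOp

variable {N m : ℕ} (V : Rn m →ₗᵢ[ℝ] Rn N) (H : Rn m →L[ℝ] Rn m)

@[simp] theorem tr_apply_self (x : Rn m) : tr V (V x) = x := by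
  refine ext_inner_left ℝ fun z => ?_
  rw [tr, ContinuousLinearMap.adjoint_inner_right]
  exact V.inner_map_map z x

/-- The operator `Φ_k(c)` for step size `h`. -/
noncomputable def phiOp (k : ℕ) (c h : ℝ) (d : Rn N) : Rn N :=
  V (phi k ((c * h) • H) (tr V d)) + (k ! : ℝ)⁻¹ • (d - V (tr V d))

theorem approxJac_apply (d : Rn N) : approxJac V H d = V (H (tr V d)) := rfl

@[simp] theorem tr_phiOp (k : ℕ) (c h : ℝ) (d : Rn N) :
    tr V (phiOp V H k c h d) = phi k ((c * h) • H) (tr V d) := by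
  simp [phiOp]

/-- The recurrence `phi_eq` survives the projection: `A = V H Vᵀ` annihilates the orthogonal
complement of the range of `V`, on which `Φ_k(c)` is just division by `k!`. -/
theorem phiOp_eq (k : ℕ) (c h : ℝ) (d : Rn N) :
    phiOp V H k c h d =
      (k ! : ℝ)⁻¹ • d + c • h • approxJac V H (phiOp V H (k + 1) c h d) := by
  rw [approxJac_apply, tr_phiOp, phiOp, phi_eq]
  simp
  module

theorem phiOp_isBigO_one (k : ℕ) (c : ℝ) {g : ℝ → Rn N}
    (hg : g =O[𝓝[>] (0 : ℝ)] fun h => h ^ 0) :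
    (fun h => phiOp V H k c h (g h)) =O[𝓝[>] (0 : ℝ)] fun h => h ^ 0 := by
  have htr := ((tr V).isBigO_comp g (𝓝[>] (0 : ℝ))).trans hg
  have h1 : (fun h => phi k ((c * h) • H) (tr V (g h))) =O[𝓝[>] (0 : ℝ)] fun h => tr V (g h) := by
    refine IsBigO.of_bound (∑' i : ℕ, ‖((i ! : ℝ)⁻¹) • H ^ i‖) ?_
    have hc : Tendsto (fun h : ℝ => |c * h|) (𝓝[>] 0) (𝓝 0) := by
      have : Continuous fun h : ℝ => |c * h| := by fun_prop
      simpa using (this.tendsto 0).mono_left nhdsWithin_le_nhds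
    filter_upwards [hc.eventually_le_const zero_lt_one] with h hh
    exact (phi k ((c * h) • H)).le_of_opNorm_le (norm_phi_smul_le k hh H) _
  have h2 : (fun h => V (phi k ((c * h) • H) (tr V (g h)))) =O[𝓝[>] (0 : ℝ)] fun h => h ^ 0 :=
    (V.toContinuousLinearMap.isBigO_comp _ _).trans (h1.trans htr)
  have h3 : (fun h => V (tr V (g h))) =O[𝓝[>] (0 : ℝ)] fun h => h ^ 0 :=
    (V.toContinuousLinearMap.isBigO_comp _ _).trans htr
  exact h2.add ((hg.sub h3).const_smul_left (k ! : ℝ)⁻¹)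

/-- The coefficients of `Φ_k(c) g(h)`. -/
noncomputable def phiShift (k : ℕ) (c : ℝ) (a : Fin 21 → ℝ) : Fin 21 → ℝ :=
  let α := ((k)! : ℝ)⁻¹
  let β := c * ((k + 1)! : ℝ)⁻¹
  let γ := c ^ 2 * ((k + 2)! : ℝ)⁻¹
  let δ := c ^ 3 * ((k + 3)! : ℝ)⁻¹
  ![α * a 0, α * a 1, α * a 2 + β * a 0, α * a 3, α * a 4, α * a 5, α * a 6 + β * a 1,
    α * a 7 + β * a 2 + γ * a 0, α * a 8, α * a 9, α * a 10, α * a 11, α * a 12 + β * a 3, α * a 13,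
    α * a 14, α * a 15, α * a 16, α * a 17 + β * a 4, α * a 18 + β * a 5,
    α * a 19 + β * a 6 + γ * a 1, α * a 20 + β * a 7 + γ * a 2 + δ * a 0]

variable {f : Rn N → Rn N} {y : Rn N} {a : Fin 21 → ℝ} {g : ℝ → Rn N}

-- Four uses of `phiOp_eq`, each gaining a factor `h A`, leave a remainder with `φ_{k+4}` of which
-- only boundedness is needed.
open HasExpansion in
theorem HasExpansion.phiOp (k : ℕ) (c : ℝ)
    (hg : HasExpansion (scaledDiff (approxJac V H) f y) 4 g a) :
    HasExpansion (scaledDiff (approxJac V H) f y) 4 (fun h => phiOp V H k c h (g h))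
      (phiShift k c a) := by
  have step {k j : ℕ} {b : Fin 21 → ℝ} (hj : j + 1 ≤ 4)
      (h : HasExpansion (scaledDiff (approxJac V H) f y) j
        (fun h => _root_.phiOp V H (k + 1) c h (g h)) b) :
      HasExpansion (scaledDiff (approxJac V H) f y) (j + 1)
        (fun h => _root_.phiOp V H k c h (g h)) ((k ! : ℝ)⁻¹ • a + c • fatShift b) := by
    simp only [phiOp_eq V H k]
    exact ((hg.mono hj).const_smul _).add ((h.smul_fat le_rfl hj).const_smul _)
  have h0 : HasExpansion (scaledDiff (approxJac V H) f y) 0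
      (fun h => _root_.phiOp V H (k + 4) c h (g h)) 0 :=
    of_isBigO_one (phiOp_isBigO_one V H _ c hg.isBigO_one)
  convert step (by norm_num) (step (by norm_num) (step (by norm_num) (step (by norm_num) h0)))
    using 1
  ext i
  fin_cases i <;> simp [phiShift, fatShift] <;> ring

end PhiOp

/-! ### The two underlying schemes -/

section Steps

variable {E : Type*} [NormedAddCommGroup E] [NormedSpace ℝ E]

/-- One step of exp4 with operators `P k c` in the role of `φ_k(c h A)` and the matrix `B` in the
defects. -/
noncomputable def exp4Step (P : ℕ → ℝ → E → E) (B : E →L[ℝ] E) (f : E → E) (y : E) (h : ℝ) : E :=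
  let k₁ := P 1 (1 / 3) (f y)
  let k₂ := P 1 (2 / 3) (f y)
  let k₃ := P 1 1 (f y)
  let w₄ := (-7 / 300 : ℝ) • k₁ + (97 / 150 : ℝ) • k₂ - (37 / 300 : ℝ) • k₃
  let d₄ := f (y + h • w₄) - f y - h • B w₄
  let k₄ := P 1 (1 / 3) d₄
  let k₅ := P 1 (2 / 3) d₄
  let k₆ := P 1 1 d₄
  let w₇ := (59 / 300 : ℝ) • k₁ - (7 / 75 : ℝ) • k₂ + (269 / 300 : ℝ) • k₃
    + (2 / 3 : ℝ) • (k₄ + k₅ + k₆)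
  let d₇ := f (y + h • w₇) - f y - h • B w₇
  let k₇ := P 1 (1 / 3) d₇
  y + h • (k₃ + k₄ - (4 / 3 : ℝ) • k₅ + k₆ + (1 / 6 : ℝ) • k₇)

/-- One step of erow4 with operators `P k c` in the role of `φ_k(c h A)` and the matrix `B` in the
defects. -/
noncomputable def erow4Step (P : ℕ → ℝ → E → E) (B : E →L[ℝ] E) (f : E → E) (y : E) (h : ℝ) : E :=
  let k₁ := P 1 (1 / 2) (f y)
  let w₂ := (1 / 2 : ℝ) • k₁
  let d₂ := f (y + h • w₂) - f y - h • B w₂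
  let k₂ := P 1 1 (f y)
  let k₃ := P 1 1 d₂
  let w₄ := k₂ + k₃
  let d₄ := f (y + h • w₄) - f y - h • B w₄
  let k₄ := P 3 1 d₂
  let k₅ := P 4 1 d₂
  let k₆ := P 3 1 d₄
  let k₇ := P 4 1 d₄
  y + h • (k₂ + (16 : ℝ) • k₄ - (48 : ℝ) • k₅ - (2 : ℝ) • k₆ + (12 : ℝ) • k₇)

end Steps

/-! ### Reduction of the four methods to the two schemes -/

section Methods

variable {N m : ℕ} (V : Rn m →ₗᵢ[ℝ] Rn N) (H : Rn m →L[ℝ] Rn m) (f : Rn N → Rn N) (y : Rn N) (h : ℝ)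

theorem phiOp_one_eq (c : ℝ) (d : Rn N) :
    phiOp V H 1 c h d = V (phi 1 ((c * h) • H) (tr V d)) + (d - V (tr V d)) := by
  simp [phiOp]

theorem phiOp_eq_one_mul (k : ℕ) (d : Rn N) :
    phiOp V H k 1 h d = V (phi k (h • H) (tr V d)) + (k ! : ℝ)⁻¹ • (d - V (tr V d)) := by
  simp [phiOp]

theorem exp4sp_eq : exp4sp N m f y V H h =
    exp4Step (fun k c => phiOp V H k c h) (fderiv ℝ f y) f y h := by
  simp only [exp4sp, exp4Step, phiOp_one_eq, one_mul]

theorem erow4sp_eq : erow4sp N m f y V H h =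
    erow4Step (fun k c => phiOp V H k c h) (fderiv ℝ f y) f y h := by
  simp only [erow4sp, erow4Step, phiOp_one_eq, phiOp_eq_one_mul, Nat.factorial_one,
    Nat.cast_one, inv_one, one_smul]

/-- In a K-type method the defects are evaluated in the reduced space. -/
theorem phiOp_defect (k : ℕ) (c : ℝ) (u w : Rn N) :
    phiOp V H k c h (f u - f y - h • approxJac V H w) =
      V (phi k ((c * h) • H) (tr V (f u) - tr V (f y) - h • H (tr V w))) +
        (k ! : ℝ)⁻¹ • ((f u - V (tr V (f u))) - (f y - V (tr V (f y)))) := by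
  simp only [phiOp, approxJac_apply, map_sub, map_smul, tr_apply_self]
  module

theorem phiOp_one_defect (c : ℝ) (u w : Rn N) :
    phiOp V H 1 c h (f u - f y - h • approxJac V H w) =
      V (phi 1 ((c * h) • H) (tr V (f u) - tr V (f y) - h • H (tr V w))) +
        (f u - V (tr V (f u))) - (f y - V (tr V (f y))) := by
  rw [phiOp_defect]
  simp
  abel

/-- The parts of the increments orthogonal to the range of `V` are killed by `Vᵀ`, so the reduced
vectors `s₄` and `s₇` are `Vᵀ w₄` and `Vᵀ w₇`, and `phiOp_defect` applies. -/
theorem exp4k_eq : exp4k N m f y V H h =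
    exp4Step (fun k c => phiOp V H k c h) (approxJac V H) f y h := by
  simp only [exp4Step, phiOp_one_defect]
  simp only [exp4k, phiOp_one_eq, map_add (tr V), map_sub (tr V), map_smul (tr V),
    tr_apply_self, sub_self, add_zero, sub_zero, one_mul]

theorem erow4k_eq : erow4k N m f y V H h =
    erow4Step (fun k c => phiOp V H k c h) (approxJac V H) f y h := by
  -- The operators with `k = 1` go first, because the method writes their orthogonal parts without a
  -- factorial; the cases `k = 3, 4` keep it.
  simp only [erow4Step, phiOp_one_defect]
  simp only [phiOp_defect]
  simp only [erow4k, phiOp_one_eq, phiOp_eq_one_mul, map_add (tr V), map_sub (tr V),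
    map_smul (tr V), tr_apply_self, sub_self, add_zero, sub_zero, one_mul, Nat.factorial_one,
    Nat.cast_one, inv_one, one_smul]

end Methods

/-! ### Evaluation of the coefficient vectors -/

section Coefficients

/-- The coefficients of the constant function with value `f(y)`. -/
def initCoeff : Fin 21 → ℝ := ![1, 0, 0, 0, 0, 0, 0, 0, 0, 0, 0, 0, 0, 0, 0, 0, 0, 0, 0, 0, 0]

/-- The coefficients of the defect `f(y + h w) - f(y) - h A w`. -/
def fatDefect (a : Fin 21 → ℝ) : Fin 21 → ℝ :=
  ![0, a 0, -a 0, a 0 ^ 2, a 1, a 2, -a 1, -a 2, a 0 ^ 3, a 0 * a 1, a 0 * a 2, a 3, -a 3, a 4, a 5,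
    a 6, a 7, -a 4, -a 5, -a 6, -a 7]

/-- The coefficients of the defect `f(y + h w) - f(y) - h f'(y) w`. -/
def meagreDefect (a : Fin 21 → ℝ) : Fin 21 → ℝ :=
  ![0, 0, 0, a 0 ^ 2, 0, 0, 0, 0, a 0 ^ 3, a 0 * a 1, a 0 * a 2, 0, 0, 0, 0, 0, 0, 0, 0, 0, 0]

/-- The coefficients of the first internal increment of exp4. -/
noncomputable def exp4Inner₁ : Fin 21 → ℝ :=
  (-7 / 300 : ℝ) • phiShift 1 (1 / 3) initCoeff + (97 / 150 : ℝ) • phiShift 1 (2 / 3) initCoeff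
    - (37 / 300 : ℝ) • phiShift 1 1 initCoeff

/-- The coefficients of the second internal increment of exp4, if `d` are those of the first
defect. -/
noncomputable def exp4Inner₂ (d : Fin 21 → ℝ) : Fin 21 → ℝ :=
  (59 / 300 : ℝ) • phiShift 1 (1 / 3) initCoeff - (7 / 75 : ℝ) • phiShift 1 (2 / 3) initCoeff
    + (269 / 300 : ℝ) • phiShift 1 1 initCoeff
    + (2 / 3 : ℝ) • (phiShift 1 (1 / 3) d + phiShift 1 (2 / 3) d + phiShift 1 1 d)

/-- The coefficients of the increment of exp4, if `d` and `d'` are those of the defects. -/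
noncomputable def exp4Outer (d d' : Fin 21 → ℝ) : Fin 21 → ℝ :=
  phiShift 1 1 initCoeff + phiShift 1 (1 / 3) d - (4 / 3 : ℝ) • phiShift 1 (2 / 3) d
    + phiShift 1 1 d + (1 / 6 : ℝ) • phiShift 1 (1 / 3) d'

/-- The coefficients of the first internal increment of erow4. -/
noncomputable def erow4Inner₁ : Fin 21 → ℝ := (1 / 2 : ℝ) • phiShift 1 (1 / 2) initCoeff

/-- The coefficients of the second internal increment of erow4, if `d` are those of the first
defect. -/
noncomputable def erow4Inner₂ (d : Fin 21 → ℝ) : Fin 21 → ℝ :=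
  phiShift 1 1 initCoeff + phiShift 1 1 d

/-- The coefficients of the increment of erow4, if `d` and `d'` are those of the defects. -/
noncomputable def erow4Outer (d d' : Fin 21 → ℝ) : Fin 21 → ℝ :=
  phiShift 1 1 initCoeff + (16 : ℝ) • phiShift 3 1 d - (48 : ℝ) • phiShift 4 1 d
    - (2 : ℝ) • phiShift 3 1 d' + (12 : ℝ) • phiShift 4 1 d'

theorem phiShift_one (c : ℝ) (a : Fin 21 → ℝ) : phiShift 1 c a =
    ![a 0, a 1, a 2 + c / 2 * a 0, a 3, a 4, a 5, a 6 + c / 2 * a 1,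
      a 7 + c / 2 * a 2 + c ^ 2 / 6 * a 0, a 8, a 9, a 10, a 11, a 12 + c / 2 * a 3, a 13, a 14, a 15,
      a 16, a 17 + c / 2 * a 4, a 18 + c / 2 * a 5, a 19 + c / 2 * a 6 + c ^ 2 / 6 * a 1,
      a 20 + c / 2 * a 7 + c ^ 2 / 6 * a 2 + c ^ 3 / 24 * a 0] := by
  simp [phiShift, Nat.factorial, div_eq_mul_inv]

theorem phiShift_three (a : Fin 21 → ℝ) : phiShift 3 1 a =
    ![a 0 / 6, a 1 / 6, a 2 / 6 + a 0 / 24, a 3 / 6, a 4 / 6, a 5 / 6, a 6 / 6 + a 1 / 24,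
      a 7 / 6 + a 2 / 24 + a 0 / 120, a 8 / 6, a 9 / 6, a 10 / 6, a 11 / 6, a 12 / 6 + a 3 / 24,
      a 13 / 6, a 14 / 6, a 15 / 6, a 16 / 6, a 17 / 6 + a 4 / 24, a 18 / 6 + a 5 / 24,
      a 19 / 6 + a 6 / 24 + a 1 / 120, a 20 / 6 + a 7 / 24 + a 2 / 120 + a 0 / 720] := by
  simp [phiShift, Nat.factorial, div_eq_inv_mul]

theorem phiShift_four (a : Fin 21 → ℝ) : phiShift 4 1 a =
    ![a 0 / 24, a 1 / 24, a 2 / 24 + a 0 / 120, a 3 / 24, a 4 / 24, a 5 / 24, a 6 / 24 + a 1 / 120,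
      a 7 / 24 + a 2 / 120 + a 0 / 720, a 8 / 24, a 9 / 24, a 10 / 24, a 11 / 24,
      a 12 / 24 + a 3 / 120, a 13 / 24, a 14 / 24, a 15 / 24, a 16 / 24, a 17 / 24 + a 4 / 120,
      a 18 / 24 + a 5 / 120, a 19 / 24 + a 6 / 120 + a 1 / 720,
      a 20 / 24 + a 7 / 120 + a 2 / 720 + a 0 / 5040] := by
  simp [phiShift, Nat.factorial, div_eq_inv_mul]

theorem exp4Inner₁_eq :
    exp4Inner₁ =
      ![1 / 2, 0, 3 / 20, 0, 0, 0, 0, 109 / 4050, 0, 0, 0, 0, 0, 0, 0, 0, 0, 0, 0, 0, 91 /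
      32400] := by
  simp only [exp4Inner₁, phiShift_one, initCoeff, Matrix.cons_val]
  simp only [Matrix.smul_cons, Matrix.cons_add, Matrix.cons_sub, Matrix.head_cons,
    Matrix.tail_cons, Matrix.smul_empty, Matrix.empty_add_empty, Matrix.empty_sub_empty,
    smul_eq_mul]
  norm_num

theorem fatDefect_exp4Inner₁ :
    fatDefect exp4Inner₁ =
      ![0, 1 / 2, -1 / 2, 1 / 4, 0, 3 / 20, 0, -3 / 20, 1 / 8, 0, 3 / 40, 0, 0, 0, 0, 0, 109
      / 4050, 0, 0, 0, -109 / 4050] := by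
  rw [exp4Inner₁_eq]
  simp only [fatDefect, Matrix.cons_val]
  norm_num

theorem exp4Inner₂_fat :
    exp4Inner₂ (fatDefect exp4Inner₁) =
      ![1, 1, -11 / 20, 1 / 2, 0, 3 / 10, 1 / 3, -1973 / 4050, 1 / 4, 0, 3 / 20, 0, 1 / 6,
      0, 0, 0, 109 / 2025, 0, 1 / 10, 7 / 81, -6601 / 32400] := by
  rw [fatDefect_exp4Inner₁]
  simp only [exp4Inner₂, phiShift_one, initCoeff, Matrix.cons_val]
  simp only [Matrix.smul_cons, Matrix.cons_add, Matrix.cons_sub, Matrix.head_cons,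
    Matrix.tail_cons, Matrix.smul_empty, Matrix.empty_add_empty, Matrix.empty_sub_empty,
    smul_eq_mul]
  norm_num

theorem fatDefect_exp4Inner₂ :
    fatDefect (exp4Inner₂ (fatDefect exp4Inner₁)) =
      ![0, 1, -1, 1, 1, -11 / 20, -1, 11 / 20, 1, 1, -11 / 20, 1 / 2, -1 / 2, 0, 3 / 10, 1 /
      3, -1973 / 4050, 0, -3 / 10, -1 / 3, 1973 / 4050] := by
  rw [exp4Inner₂_fat]
  simp only [fatDefect, Matrix.cons_val]
  norm_num

/-- The entry `1/12` at index 11 comes from the last stage alone: the first defect vanishes there,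
the second has entry `1/2`, and its weight is `1/6`. -/
theorem exp4Outer_fat :
    exp4Outer (fatDefect exp4Inner₁) (fatDefect (exp4Inner₂ (fatDefect exp4Inner₁))) =
      exp4kCoeff := by
  rw [fatDefect_exp4Inner₂, fatDefect_exp4Inner₁]
  simp only [exp4Outer, exp4kCoeff, phiShift_one, initCoeff, Matrix.cons_val]
  simp only [Matrix.smul_cons, Matrix.cons_add, Matrix.cons_sub, Matrix.head_cons,
    Matrix.tail_cons, Matrix.smul_empty, Matrix.empty_add_empty, Matrix.empty_sub_empty,
    smul_eq_mul]
  norm_num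

theorem meagreDefect_exp4Inner₁ :
    meagreDefect exp4Inner₁ =
      ![0, 0, 0, 1 / 4, 0, 0, 0, 0, 1 / 8, 0, 3 / 40, 0, 0, 0, 0, 0, 0, 0, 0, 0, 0] := by
  rw [exp4Inner₁_eq]
  simp only [meagreDefect, Matrix.cons_val]
  norm_num

theorem exp4Inner₂_meagre :
    exp4Inner₂ (meagreDefect exp4Inner₁) =
      ![1, 0, 9 / 20, 1 / 2, 0, 0, 0, 296 / 2025, 1 / 4, 0, 3 / 20, 0, 1 / 6, 0, 0, 0, 0, 0,
      0, 0, 1183 / 32400] := by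
  rw [meagreDefect_exp4Inner₁]
  simp only [exp4Inner₂, phiShift_one, initCoeff, Matrix.cons_val]
  simp only [Matrix.smul_cons, Matrix.cons_add, Matrix.cons_sub, Matrix.head_cons,
    Matrix.tail_cons, Matrix.smul_empty, Matrix.empty_add_empty, Matrix.empty_sub_empty,
    smul_eq_mul]
  norm_num

theorem meagreDefect_exp4Inner₂ :
    meagreDefect (exp4Inner₂ (meagreDefect exp4Inner₁)) =
      ![0, 0, 0, 1, 0, 0, 0, 0, 1, 0, 9 / 20, 0, 0, 0, 0, 0, 0, 0, 0, 0, 0] := by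
  rw [exp4Inner₂_meagre]
  simp only [meagreDefect, Matrix.cons_val]
  norm_num

/-- Subtracting `h f'(y) w` removes every tree with a singly branched meagre root from the defects,
and `Φ_k(c)` creates only fat roots. This is why the entry at index 11 is zero. -/
theorem exp4Outer_meagre :
    exp4Outer (meagreDefect exp4Inner₁)
      (meagreDefect (exp4Inner₂ (meagreDefect exp4Inner₁))) =
      exp4spCoeff := by
  rw [meagreDefect_exp4Inner₂, meagreDefect_exp4Inner₁]
  simp only [exp4Outer, exp4spCoeff, phiShift_one, initCoeff, Matrix.cons_val]
  simp only [Matrix.smul_cons, Matrix.cons_add, Matrix.cons_sub, Matrix.head_cons,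
    Matrix.tail_cons, Matrix.smul_empty, Matrix.empty_add_empty, Matrix.empty_sub_empty,
    smul_eq_mul]
  norm_num

theorem erow4Inner₁_eq :
    erow4Inner₁ =
      ![1 / 2, 0, 1 / 8, 0, 0, 0, 0, 1 / 48, 0, 0, 0, 0, 0, 0, 0, 0, 0, 0, 0, 0, 1 / 384] := by
  simp only [erow4Inner₁, phiShift_one, initCoeff, Matrix.cons_val]
  simp only [Matrix.smul_cons, Matrix.smul_empty, smul_eq_mul]
  norm_num

theorem fatDefect_erow4Inner₁ :
    fatDefect erow4Inner₁ =
      ![0, 1 / 2, -1 / 2, 1 / 4, 0, 1 / 8, 0, -1 / 8, 1 / 8, 0, 1 / 16, 0, 0, 0, 0, 0, 1 /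
      48, 0, 0, 0, -1 / 48] := by
  rw [erow4Inner₁_eq]
  simp only [fatDefect, Matrix.cons_val]
  norm_num

theorem erow4Inner₂_fat :
    erow4Inner₂ (fatDefect erow4Inner₁) =
      ![1, 1 / 2, 0, 1 / 4, 0, 1 / 8, 1 / 4, -5 / 24, 1 / 8, 0, 1 / 16, 0, 1 / 8, 0, 0, 0, 1
      / 48, 0, 1 / 16, 1 / 12, -1 / 8] := by
  rw [fatDefect_erow4Inner₁]
  simp only [erow4Inner₂, phiShift_one, initCoeff, Matrix.cons_val]
  simp only [Matrix.cons_add, Matrix.head_cons, Matrix.tail_cons, Matrix.empty_add_empty]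
  norm_num

theorem fatDefect_erow4Inner₂ :
    fatDefect (erow4Inner₂ (fatDefect erow4Inner₁)) =
      ![0, 1, -1, 1, 1 / 2, 0, -1 / 2, 0, 1, 1 / 2, 0, 1 / 4, -1 / 4, 0, 1 / 8, 1 / 4, -5 /
      24, 0, -1 / 8, -1 / 4, 5 / 24] := by
  rw [erow4Inner₂_fat]
  simp only [fatDefect, Matrix.cons_val]
  norm_num

theorem erow4Outer_fat :
    erow4Outer (fatDefect erow4Inner₁) (fatDefect (erow4Inner₂ (fatDefect erow4Inner₁))) =
      erow4kCoeff := by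
  rw [fatDefect_erow4Inner₂, fatDefect_erow4Inner₁]
  simp only [erow4Outer, erow4kCoeff, phiShift_one, phiShift_three, phiShift_four, initCoeff, Matrix.cons_val]
  simp only [Matrix.smul_cons, Matrix.cons_add, Matrix.cons_sub, Matrix.head_cons,
    Matrix.tail_cons, Matrix.smul_empty, Matrix.empty_add_empty, Matrix.empty_sub_empty,
    smul_eq_mul]
  norm_num

theorem meagreDefect_erow4Inner₁ :
    meagreDefect erow4Inner₁ =
      ![0, 0, 0, 1 / 4, 0, 0, 0, 0, 1 / 8, 0, 1 / 16, 0, 0, 0, 0, 0, 0, 0, 0, 0, 0] := by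
  rw [erow4Inner₁_eq]
  simp only [meagreDefect, Matrix.cons_val]
  norm_num

theorem erow4Inner₂_meagre :
    erow4Inner₂ (meagreDefect erow4Inner₁) =
      ![1, 0, 1 / 2, 1 / 4, 0, 0, 0, 1 / 6, 1 / 8, 0, 1 / 16, 0, 1 / 8, 0, 0, 0, 0, 0, 0, 0,
      1 / 24] := by
  rw [meagreDefect_erow4Inner₁]
  simp only [erow4Inner₂, phiShift_one, initCoeff, Matrix.cons_val]
  simp only [Matrix.cons_add, Matrix.head_cons, Matrix.tail_cons, Matrix.empty_add_empty]
  norm_num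

theorem meagreDefect_erow4Inner₂ :
    meagreDefect (erow4Inner₂ (meagreDefect erow4Inner₁)) =
      ![0, 0, 0, 1, 0, 0, 0, 0, 1, 0, 1 / 2, 0, 0, 0, 0, 0, 0, 0, 0, 0, 0] := by
  rw [erow4Inner₂_meagre]
  simp only [meagreDefect, Matrix.cons_val]
  norm_num

theorem erow4Outer_meagre :
    erow4Outer (meagreDefect erow4Inner₁)
      (meagreDefect (erow4Inner₂ (meagreDefect erow4Inner₁))) =
      erow4spCoeff := by
  rw [meagreDefect_erow4Inner₂, meagreDefect_erow4Inner₁]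
  simp only [erow4Outer, erow4spCoeff, phiShift_one, phiShift_three, phiShift_four, initCoeff, Matrix.cons_val]
  simp only [Matrix.smul_cons, Matrix.cons_add, Matrix.cons_sub, Matrix.head_cons,
    Matrix.tail_cons, Matrix.smul_empty, Matrix.empty_add_empty, Matrix.empty_sub_empty,
    smul_eq_mul]
  norm_num

end Coefficients

/-! ### B-series of the four methods -/

section MethodSeries

theorem hasExpansion_initCoeff {E : Type*} [NormedAddCommGroup E] [NormedSpace ℝ E]
    {A : E →L[ℝ] E} {f : E → E} {y : E} {n : ℕ} :
    HasExpansion (scaledDiff A f y) n (fun _ => f y) initCoeff := by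
  refine (isBigO_zero _ _).congr_left fun h => ?_
  simp [expansion, term₀, term₁, term₂, term₃, scaledDiff, initCoeff]

theorem compShift_sub_fatShift (a : Fin 21 → ℝ) :
    HasExpansion.compShift a - initCoeff - HasExpansion.fatShift a = fatDefect a := by
  ext i
  fin_cases i <;> simp [HasExpansion.compShift, initCoeff, HasExpansion.fatShift, fatDefect]

theorem compShift_sub_meagreShift (a : Fin 21 → ℝ) :
    HasExpansion.compShift a - initCoeff - HasExpansion.meagreShift a = meagreDefect a := by
  ext i
  fin_cases i <;> simp [HasExpansion.compShift, initCoeff, HasExpansion.meagreShift, meagreDefect]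

namespace HasExpansion

variable {N m : ℕ} {V : Rn m →ₗᵢ[ℝ] Rn N} {H : Rn m →L[ℝ] Rn m} {f : Rn N → Rn N} {y : Rn N}
  {a : Fin 21 → ℝ} {g : ℝ → Rn N} {A : Rn N →L[ℝ] Rn N}

theorem fat_defect (hf : ContDiff ℝ ∞ f) (hg : HasExpansion (scaledDiff A f y) 4 g a) :
    HasExpansion (scaledDiff A f y) 4 (fun h => f (y + h • g h) - f y - h • A (g h))
      (fatDefect a) := by
  rw [← compShift_sub_fatShift]
  exact ((hg.comp hf (by norm_num) le_rfl).sub hasExpansion_initCoeff).sub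
    (hg.smul_fat (by norm_num) le_rfl)

theorem meagre_defect (hf : ContDiff ℝ ∞ f) (hg : HasExpansion (scaledDiff A f y) 4 g a) :
    HasExpansion (scaledDiff A f y) 4 (fun h => f (y + h • g h) - f y - h • fderiv ℝ f y (g h))
      (meagreDefect a) := by
  rw [← compShift_sub_meagreShift]
  exact ((hg.comp hf (by norm_num) le_rfl).sub hasExpansion_initCoeff).sub
    (hg.smul_fderiv (by norm_num) le_rfl)

theorem isBigO_add_smul (hg : HasExpansion (scaledDiff A f y) 4 g a) :
    (fun h => y + h • g h - bSeries4 a A f y h) =O[𝓝[>] (0 : ℝ)] fun h => h ^ 5 := by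
  refine (IsBigO.pow_smul hg 1).congr_left fun h => ?_
  rw [bSeries4_eq]
  module

variable (V H) in
-- Leaving `B` and its coefficient rule `D` abstract covers the K-type (`fatDefect`) and the single
-- projection method (`meagreDefect`) with one argument.
theorem exp4Step (B : Rn N →L[ℝ] Rn N) (D : (Fin 21 → ℝ) → Fin 21 → ℝ)
    (hD : ∀ {g a}, HasExpansion (scaledDiff (approxJac V H) f y) 4 g a →
      HasExpansion (scaledDiff (approxJac V H) f y) 4
        (fun h => f (y + h • g h) - f y - h • B (g h)) (D a)) :
    (fun h => _root_.exp4Step (fun k c => _root_.phiOp V H k c h) B f y h -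
        bSeries4 (exp4Outer (D exp4Inner₁) (D (exp4Inner₂ (D exp4Inner₁)))) (approxJac V H) f y h)
      =O[𝓝[>] (0 : ℝ)] fun h => h ^ 5 := by
  have h0 (c : ℝ) := phiOp V H 1 c (hasExpansion_initCoeff (n := 4) (A := approxJac V H) (f := f)
    (y := y))
  have hw₄ : HasExpansion _ 4 _ exp4Inner₁ := (((h0 (1 / 3)).const_smul (-7 / 300)).add
    ((h0 (2 / 3)).const_smul (97 / 150))).sub ((h0 1).const_smul (37 / 300))
  have hd₄ := fun c => phiOp V H 1 c (hD hw₄)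
  have hw₇ : HasExpansion _ 4 _ (exp4Inner₂ (D exp4Inner₁)) := ((((h0 (1 / 3)).const_smul (59 / 300)).sub
    ((h0 (2 / 3)).const_smul (7 / 75))).add ((h0 1).const_smul (269 / 300))).add
    ((((hd₄ (1 / 3)).add (hd₄ (2 / 3))).add (hd₄ 1)).const_smul (2 / 3))
  have hd₇ := phiOp V H 1 (1 / 3) (hD hw₇)
  have hout : HasExpansion _ 4 _ (exp4Outer (D exp4Inner₁) (D (exp4Inner₂ (D exp4Inner₁)))) :=
    ((((h0 1).add (hd₄ (1 / 3))).sub ((hd₄ (2 / 3)).const_smul (4 / 3))).add (hd₄ 1)).add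
      (hd₇.const_smul (1 / 6))
  refine (isBigO_add_smul hout).congr_left fun h => ?_
  refine congrArg (· - _) ?_
  simp only [_root_.exp4Step]

variable (V H) in
theorem erow4Step (B : Rn N →L[ℝ] Rn N) (D : (Fin 21 → ℝ) → Fin 21 → ℝ)
    (hD : ∀ {g a}, HasExpansion (scaledDiff (approxJac V H) f y) 4 g a →
      HasExpansion (scaledDiff (approxJac V H) f y) 4
        (fun h => f (y + h • g h) - f y - h • B (g h)) (D a)) :
    (fun h => _root_.erow4Step (fun k c => _root_.phiOp V H k c h) B f y h -
        bSeries4 (erow4Outer (D erow4Inner₁) (D (erow4Inner₂ (D erow4Inner₁))))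
          (approxJac V H) f y h)
      =O[𝓝[>] (0 : ℝ)] fun h => h ^ 5 := by
  have h0 (c : ℝ) := phiOp V H 1 c (hasExpansion_initCoeff (n := 4) (A := approxJac V H) (f := f)
    (y := y))
  have hw₂ : HasExpansion _ 4 _ erow4Inner₁ := (h0 (1 / 2)).const_smul (1 / 2)
  have hd₂ := fun k => phiOp V H k 1 (hD hw₂)
  have hw₄ : HasExpansion _ 4 _ (erow4Inner₂ (D erow4Inner₁)) := (h0 1).add (hd₂ 1)
  have hd₄ := fun k => phiOp V H k 1 (hD hw₄)
  have hout : HasExpansion _ 4 _ (erow4Outer (D erow4Inner₁) (D (erow4Inner₂ (D erow4Inner₁)))) :=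
    ((((h0 1).add ((hd₂ 3).const_smul 16)).sub ((hd₂ 4).const_smul 48)).sub
      ((hd₄ 3).const_smul 2)).add ((hd₄ 4).const_smul 12)
  refine (isBigO_add_smul hout).congr_left fun h => ?_
  refine congrArg (· - _) ?_
  simp only [_root_.erow4Step]

end HasExpansion

theorem hasBSeries_exp4k : HasBSeries exp4k exp4kCoeff := by
  intro N m f y V H hf
  simp only [exp4k_eq, ← exp4Outer_fat]
  exact HasExpansion.exp4Step V H _ _ fun hg => hg.fat_defect hf

theorem hasBSeries_exp4sp : HasBSeries exp4sp exp4spCoeff := by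
  intro N m f y V H hf
  simp only [exp4sp_eq, ← exp4Outer_meagre]
  exact HasExpansion.exp4Step V H _ _ fun hg => hg.meagre_defect hf

theorem hasBSeries_erow4k : HasBSeries erow4k erow4kCoeff := by
  intro N m f y V H hf
  simp only [erow4k_eq, ← erow4Outer_fat]
  exact HasExpansion.erow4Step V H _ _ fun hg => hg.fat_defect hf

theorem hasBSeries_erow4sp : HasBSeries erow4sp erow4spCoeff := by
  intro N m f y V H hf
  simp only [erow4sp_eq, ← erow4Outer_meagre]
  exact HasExpansion.erow4Step V H _ _ fun hg => hg.meagre_defect hf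

end MethodSeries

/-! ### B-series of the exact solution -/

section Exact

theorem expansion_isBigO_one {E : Type*} [NormedAddCommGroup E] [NormedSpace ℝ E]
    (a : Fin 21 → ℝ) (T : Fin 21 → E) :
    expansion a T =O[𝓝[>] (0 : ℝ)] fun h => h ^ 0 := by
  have h1 := ((isBigO_const_pow_zero (term₀ a T)).add
    ((isBigO_pow_smul_const 1 (term₁ a T)).pow_mono (Nat.zero_le _))).add
    ((isBigO_pow_smul_const 2 (term₂ a T)).pow_mono (Nat.zero_le _)) |>.add
    ((isBigO_pow_smul_const 3 (term₃ a T)).pow_mono (Nat.zero_le _))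
  exact h1.congr_left fun h => by rw [expansion, pow_one]

/-- The coefficients of the exact solution are reproduced by one Picard iteration. -/
theorem compShift_exactCoeff (i : Fin 21) :
    HasExpansion.compShift exactCoeff i = TWTree.ord i * exactCoeff i := by
  fin_cases i <;> simp [HasExpansion.compShift, exactCoeff, TWTree.ord] <;> norm_num

variable {N : ℕ} {f : Rn N → Rn N} {y : Rn N} {z : ℝ → Rn N} {A : Rn N →L[ℝ] Rn N}

theorem hasDerivAt_smul_expansion (a : Fin 21 → ℝ) (T : Fin 21 → Rn N) (t : ℝ) :
    HasDerivAt (fun t : ℝ => t • expansion a T t)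
      (expansion (fun i => TWTree.ord i * a i) T t) t := by
  have h1 : HasDerivAt (fun t : ℝ => t • term₀ a T + t ^ 2 • term₁ a T + t ^ 3 • term₂ a T +
      t ^ 4 • term₃ a T) _ t :=
    ((((hasDerivAt_id t).smul_const _).add ((hasDerivAt_pow 2 t).smul_const _)).add
      ((hasDerivAt_pow 3 t).smul_const _)).add ((hasDerivAt_pow 4 t).smul_const _)
  convert h1 using 1
  · ext1 t
    rw [expansion]
    module
  · simp [expansion, term₀, term₁, term₂, term₃, TWTree.ord]
    module

theorem nhdsGT_le_nhdsWithin_Icc {T : ℝ} (hT : 0 < T) : 𝓝[>] (0 : ℝ) ≤ 𝓝[Icc 0 T] 0 := by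
  rw [← nhdsWithin_Ioc_eq_nhdsGT hT]
  exact nhdsWithin_mono _ Ioc_subset_Icc_self

/-- Differentiability of `z` at `0` bounds the difference quotient, which is all that the start of
the bootstrap requires; hence any `a` is allowed. -/
theorem IsSolution.hasExpansion_zero (hz : IsSolution f y z) (a : Fin 21 → ℝ) (T : Fin 21 → Rn N) :
    HasExpansion T 0 (fun h => h⁻¹ • (z h - y)) a := by
  obtain ⟨h0, τ, hτ, hd⟩ := hz
  have h1 := ((hd 0 ⟨le_rfl, hτ.le⟩).hasFDerivWithinAt.isBigO_sub).mono
    (nhdsGT_le_nhdsWithin_Icc hτ)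
  have h2 : (fun h => h⁻¹ • (z h - y)) =O[𝓝[>] (0 : ℝ)] fun h => h ^ 0 := by
    have := (isBigO_refl (fun h : ℝ => h⁻¹) (𝓝[>] 0)).smul h1
    simp only [h0, sub_zero] at this
    refine this.trans (IsBigO.of_bound 1 ?_)
    filter_upwards [self_mem_nhdsWithin] with h hh
    have : h ≠ 0 := ne_of_gt hh
    simp [this]
  exact h2.sub (expansion_isBigO_one a T)

/-- One Picard iteration. Composition with `f` gains an order, and by `compShift_exactCoeff` its
coefficients are those of the derivative of `t • expansion exactCoeff T t`. The mean value
inequality integrates this estimate, and division by `h` returns to the difference quotient. -/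
theorem IsSolution.hasExpansion_succ (hf : ContDiff ℝ ∞ f) (hz : IsSolution f y z) {n : ℕ}
    (hn : n + 1 ≤ 4)
    (hg : HasExpansion (scaledDiff A f y) n (fun h => h⁻¹ • (z h - y)) exactCoeff) :
    HasExpansion (scaledDiff A f y) (n + 1) (fun h => h⁻¹ • (z h - y)) exactCoeff := by
  obtain ⟨h0, τ, hτ, hd⟩ := hz
  set T := scaledDiff A f y with hT
  have hc : HasExpansion T (n + 1) (fun h => f (y + h • h⁻¹ • (z h - y)))
    (HasExpansion.compShift exactCoeff) := hg.comp hf le_rfl hn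
  set R : ℝ → Rn N := fun t => f (z t) - expansion (fun i => TWTree.ord i * exactCoeff i) T t
    with hR
  have hcoeff : (fun i => TWTree.ord i * exactCoeff i) = HasExpansion.compShift exactCoeff :=
    funext fun i => (compShift_exactCoeff i).symm
  have hR' : R =O[𝓝[>] (0 : ℝ)] fun h => h ^ (n + 1) := by
    refine hc.congr' ?_ EventuallyEq.rfl
    filter_upwards [self_mem_nhdsWithin] with h hh
    rw [hR, smul_inv_smul₀ (ne_of_gt hh), hcoeff, add_sub_cancel]
  -- The `O`-bound concerns positive arguments only, but the mean value inequality on `[0, h]` also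
  -- needs the endpoint `0`.
  have hR0 : R 0 = 0 := by
    simp [hR, h0, expansion, term₀, exactCoeff, TWTree.ord, hT, scaledDiff]
  obtain ⟨C, hC⟩ := hR'.bound
  obtain ⟨δ, hδ, hb⟩ := mem_nhdsGT_iff_exists_Ioo_subset.1 hC
  have hδ : 0 < δ := hδ
  -- `C` may be negative; its absolute value makes the bound monotone in `t`, so the value at `h`
  -- dominates on `[0, h]`.
  refine IsBigO.of_bound (|C|) ?_
  filter_upwards [Ioo_mem_nhdsGT (lt_min hτ hδ)] with h hh
  have hhτ : h < τ := hh.2.trans_le (min_le_left _ _)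
  have hhδ : h < δ := hh.2.trans_le (min_le_right _ _)
  have key := (convex_Icc 0 h).norm_image_sub_le_of_norm_hasDerivWithin_le
    (f := fun t => z t - t • expansion exactCoeff T t) (f' := R) (C := |C| * h ^ (n + 1))
    (x := 0) (y := h)
    (fun t ht => ((hd t ⟨ht.1, ht.2.trans hhτ.le⟩).mono
      (Icc_subset_Icc_right hhτ.le)).sub (hasDerivAt_smul_expansion _ _ t).hasDerivWithinAt)
    (fun t ht => ?_) (left_mem_Icc.2 hh.1.le) (right_mem_Icc.2 hh.1.le)
  · rw [zero_smul, sub_zero, sub_zero, h0, Real.norm_of_nonneg hh.1.le] at key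
    have e : h⁻¹ • (z h - y) - expansion exactCoeff T h =
        h⁻¹ • (z h - h • expansion exactCoeff T h - y) := by
      rw [sub_right_comm, smul_sub _ (z h - y), inv_smul_smul₀ hh.1.ne']
    rw [e, norm_smul, norm_inv, Real.norm_of_nonneg hh.1.le,
      Real.norm_of_nonneg (pow_nonneg hh.1.le _), inv_mul_le_iff₀ hh.1, mul_comm h]
    exact key
  · rcases ht.1.eq_or_lt with rfl | ht0
    · rw [hR0, norm_zero]
      have := hh.1.le
      positivity
    · have := hb ⟨ht0, ht.2.trans_lt hhδ⟩
      rw [mem_ofPred_eq, Real.norm_of_nonneg (pow_nonneg ht.1 _)] at this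
      have h2 : t ^ (n + 1) ≤ h ^ (n + 1) := pow_le_pow_left₀ ht.1 ht.2 _
      calc ‖R t‖ ≤ C * t ^ (n + 1) := this
        _ ≤ |C| * t ^ (n + 1) := by gcongr; exact le_abs_self C
        _ ≤ |C| * h ^ (n + 1) := by gcongr

theorem exactHasBSeries_exactCoeff : ExactHasBSeries exactCoeff := by
  intro N f y A z hf hz
  have h4 := hz.hasExpansion_succ hf (by norm_num) (hz.hasExpansion_succ hf (by norm_num)
    (hz.hasExpansion_succ hf (by norm_num) (hz.hasExpansion_succ hf (by norm_num)
      (hz.hasExpansion_zero exactCoeff (scaledDiff A f y)))))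
  refine h4.isBigO_add_smul.congr' ?_ EventuallyEq.rfl
  filter_upwards [self_mem_nhdsWithin] with h hh
  rw [smul_inv_smul₀ (ne_of_gt hh), add_sub_cancel]

end Exact

/-! ### Polynomial vector fields with prescribed derivatives -/

section Cubic

variable {E : Type*} [NormedAddCommGroup E] [NormedSpace ℝ E]

/-- The cubic map with prescribed derivatives at the origin. -/
noncomputable def cubicMap (e : E) (L : E →L[ℝ] E) (Q : E →L[ℝ] E →L[ℝ] E)
    (C : E →L[ℝ] E →L[ℝ] E →L[ℝ] E) (x : E) : E :=
  e + L x + (1 / 2 : ℝ) • Q x x + (1 / 6 : ℝ) • C x x x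

variable (e : E) (L : E →L[ℝ] E) (Q : E →L[ℝ] E →L[ℝ] E) (C : E →L[ℝ] E →L[ℝ] E →L[ℝ] E)

theorem contDiff_cubicMap : ContDiff ℝ ∞ (cubicMap e L Q C) := by
  unfold cubicMap
  fun_prop

theorem cubicMap_zero : cubicMap e L Q C 0 = e := by simp [cubicMap]

variable (hQ : ∀ u v, Q u v = Q v u) (hC : ∀ u v, C u v = C v u)
  (hC' : ∀ u v w, C u v w = C u w v)
include hQ hC hC'

theorem fderiv_cubicMap :
    fderiv ℝ (cubicMap e L Q C) = fun x => L + Q x + (1 / 2 : ℝ) • C x x := by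
  ext1 x
  have h : HasFDerivAt (fun x => e + L x + (1 / 2 : ℝ) • Q x x + (1 / 6 : ℝ) • C x x x) _ x :=
    ((L.hasFDerivAt.const_add e).add ((Q.hasFDerivAt.clm_apply (hasFDerivAt_id x)).const_smul
      (1 / 2 : ℝ))).add (((C.hasFDerivAt.clm_apply (hasFDerivAt_id x)).clm_apply
        (hasFDerivAt_id x)).const_smul (1 / 6 : ℝ))
  refine h.fderiv.trans ?_
  ext u
  simp [hQ u x, hC u x, hC' x u x]
  module

omit hQ hC' in
theorem fderiv_quadratic :
    fderiv ℝ (fun x => L + Q x + (1 / 2 : ℝ) • C x x) = fun x => Q + C x := by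
  ext1 x
  have h : HasFDerivAt (fun x => L + Q x + (1 / 2 : ℝ) • C x x) _ x :=
    (Q.hasFDerivAt.const_add L).add ((C.hasFDerivAt.clm_apply (hasFDerivAt_id x)).const_smul
      (1 / 2 : ℝ))
  refine h.fderiv.trans ?_
  ext u v
  simp [hC u x]
  module

theorem fderiv_cubicMap_zero : fderiv ℝ (cubicMap e L Q C) 0 = L := by
  simp [fderiv_cubicMap e L Q C hQ hC hC']

theorem secondDeriv_cubicMap_zero : secondDeriv (cubicMap e L Q C) 0 = Q := by
  rw [secondDeriv, fderiv_cubicMap e L Q C hQ hC hC', fderiv_quadratic L Q C hC]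
  simp

theorem thirdDeriv_cubicMap_zero : thirdDeriv (cubicMap e L Q C) 0 = C := by
  rw [thirdDeriv, fderiv_cubicMap e L Q C hQ hC hC', fderiv_quadratic L Q C hC]
  exact (C.hasFDerivAt.const_add Q).fderiv

end Cubic

theorem exists_isSolution {N : ℕ} {f : Rn N → Rn N} (hf : ContDiff ℝ ∞ f) (y : Rn N) :
    ∃ z, IsSolution f y z := by
  obtain ⟨z, h0, ε, hε, hz⟩ :=
    (hf.contDiffAt.of_le (by simp) :
      ContDiffAt ℝ 1 f y).exists_forall_mem_closedBall_exists_eq_forall_mem_Ioo_hasDerivAt₀ 0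
  -- Picard–Lindelöf gives an open interval of radius `ε`; halving it makes room for a closed one.
  refine ⟨z, h0, ε / 2, by positivity, fun t ht => (hz t ⟨?_, ?_⟩).hasDerivWithinAt⟩
  · linarith [ht.1]
  · linarith [ht.2]

theorem eq_zero_of_isBigO_pow {r : ℝ} {k n : ℕ} (hk : k < n)
    (h : (fun x : ℝ => r * x ^ k) =O[𝓝[>] (0 : ℝ)] fun x => x ^ n) : r = 0 := by
  have h1 : (fun x : ℝ => r * x ^ k) =o[𝓝[>] (0 : ℝ)] fun x => x ^ k :=
    h.trans_isLittleO ((isLittleO_pow_pow hk).mono nhdsWithin_le_nhds)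
  refine tendsto_nhds_unique ?_ h1.tendsto_div_nhds_zero
  refine tendsto_const_nhds.congr' ?_
  filter_upwards [self_mem_nhdsWithin] with x hx
  have : x ^ k ≠ 0 := pow_ne_zero _ (ne_of_gt hx)
  field_simp

/-! ### Linear independence of elementary differentials and uniqueness of coefficients -/

section Universal

/-- The basis vectors of the space spanned by the trees of order at most four. -/
noncomputable def treeVec (i : Fin 21) : Rn 21 := EuclideanSpace.single i 1

/-- The linear map that maps the basis vectors of the first eight trees according to `s`. -/
noncomputable def graftMap (s : Fin 8 → Fin 21) : Rn 21 →L[ℝ] Rn 21 :=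
  ∑ j : Fin 8, (EuclideanSpace.proj (j.castLE (by norm_num) : Fin 21) :
    Rn 21 →L[ℝ] ℝ).smulRight (treeVec (s j))

/-- The grafts of the trees of order at most three onto a meagre root. -/
noncomputable def meagreGraft : Rn 21 →L[ℝ] Rn 21 := graftMap ![1, 4, 5, 11, 13, 14, 15, 16]

/-- The grafts of the trees of order at most three onto a fat root. -/
noncomputable def fatGraft : Rn 21 →L[ℝ] Rn 21 := graftMap ![2, 6, 7, 12, 17, 18, 19, 20]

/-- The product of two coordinates, multiplied by a basis vector. -/
noncomputable def bilinGraft (i j k : Fin 21) : Rn 21 →L[ℝ] Rn 21 →L[ℝ] Rn 21 :=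
  (EuclideanSpace.proj i : Rn 21 →L[ℝ] ℝ).smulRight
    ((EuclideanSpace.proj j : Rn 21 →L[ℝ] ℝ).smulRight (treeVec k))

/-- The grafts of pairs of trees onto a meagre root. -/
noncomputable def pairGraft : Rn 21 →L[ℝ] Rn 21 →L[ℝ] Rn 21 :=
  (2 : ℝ) • bilinGraft 0 0 3 + (bilinGraft 0 1 9 + bilinGraft 1 0 9)
    + (bilinGraft 0 2 10 + bilinGraft 2 0 10)

/-- The graft of three one-vertex trees onto a meagre root. -/
noncomputable def tripleGraft : Rn 21 →L[ℝ] Rn 21 →L[ℝ] Rn 21 →L[ℝ] Rn 21 :=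
  (EuclideanSpace.proj 0 : Rn 21 →L[ℝ] ℝ).smulRight ((6 : ℝ) • bilinGraft 0 0 8)

/-- A vector field whose elementary differentials are linearly independent. -/
noncomputable def universalField : Rn 21 → Rn 21 :=
  cubicMap (treeVec 0) meagreGraft pairGraft tripleGraft

theorem contDiff_universalField : ContDiff ℝ ∞ universalField := contDiff_cubicMap _ _ _ _

theorem bilinGraft_apply (i j k : Fin 21) (u v : Rn 21) :
    bilinGraft i j k u v = (u i * v j) • treeVec k := by
  simp [bilinGraft, smul_smul]

theorem pairGraft_symm (u v : Rn 21) : pairGraft u v = pairGraft v u := by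
  simp [pairGraft, bilinGraft_apply]
  module

theorem tripleGraft_apply (u v w : Rn 21) :
    tripleGraft u v w = (6 * u 0 * v 0 * w 0) • treeVec 8 := by
  simp [tripleGraft, bilinGraft_apply]
  module

theorem graftMap_treeVec (s : Fin 8 → Fin 21) (j : Fin 8) :
    graftMap s (treeVec (j.castLE (by norm_num))) = treeVec (s j) := by
  simp [graftMap, treeVec]

theorem meagreGraft_treeVec (j : Fin 8) : meagreGraft (treeVec (j.castLE (by norm_num))) =
    treeVec ((![1, 4, 5, 11, 13, 14, 15, 16] : Fin 8 → Fin 21) j) := graftMap_treeVec _ j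

theorem fatGraft_treeVec (j : Fin 8) : fatGraft (treeVec (j.castLE (by norm_num))) =
    treeVec ((![2, 6, 7, 12, 17, 18, 19, 20] : Fin 8 → Fin 21) j) := graftMap_treeVec _ j

/-- The derivatives at the origin are grafting operations on the free space over the trees. The
factors 2 in `pairGraft` and 6 in `tripleGraft` cancel the symmetry coefficients of `tau 3` and `tau
8`. -/
theorem scaledDiff_universalField (i : Fin 21) :
    scaledDiff fatGraft universalField 0 i = treeVec i := by
  have hC (u v : Rn 21) : tripleGraft u v = tripleGraft v u := by
    ext1 w; simp only [tripleGraft_apply]; ring_nf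
  have hC' (u v w : Rn 21) : tripleGraft u v w = tripleGraft u w v := by
    simp only [tripleGraft_apply]; ring_nf
  have h0 : universalField 0 = treeVec 0 := cubicMap_zero _ _ _ _
  have h1 : fderiv ℝ universalField 0 = meagreGraft :=
    fderiv_cubicMap_zero _ _ _ _ pairGraft_symm hC hC'
  have h2 : secondDeriv universalField 0 = pairGraft :=
    secondDeriv_cubicMap_zero _ _ _ _ pairGraft_symm hC hC'
  have h3 : thirdDeriv universalField 0 = tripleGraft :=
    thirdDeriv_cubicMap_zero _ _ _ _ pairGraft_symm hC hC'
  have m0 : meagreGraft (treeVec 0) = treeVec 1 := meagreGraft_treeVec 0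
  have m1 : meagreGraft (treeVec 1) = treeVec 4 := meagreGraft_treeVec 1
  have m2 : meagreGraft (treeVec 2) = treeVec 5 := meagreGraft_treeVec 2
  have m3 : meagreGraft (treeVec 3) = treeVec 11 := meagreGraft_treeVec 3
  have m4 : meagreGraft (treeVec 4) = treeVec 13 := meagreGraft_treeVec 4
  have m5 : meagreGraft (treeVec 5) = treeVec 14 := meagreGraft_treeVec 5
  have m6 : meagreGraft (treeVec 6) = treeVec 15 := meagreGraft_treeVec 6
  have m7 : meagreGraft (treeVec 7) = treeVec 16 := meagreGraft_treeVec 7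
  have f0 : fatGraft (treeVec 0) = treeVec 2 := fatGraft_treeVec 0
  have f1 : fatGraft (treeVec 1) = treeVec 6 := fatGraft_treeVec 1
  have f2 : fatGraft (treeVec 2) = treeVec 7 := fatGraft_treeVec 2
  have f3 : fatGraft (treeVec 3) = treeVec 12 := fatGraft_treeVec 3
  have f4 : fatGraft (treeVec 4) = treeVec 17 := fatGraft_treeVec 4
  have f5 : fatGraft (treeVec 5) = treeVec 18 := fatGraft_treeVec 5
  have f6 : fatGraft (treeVec 6) = treeVec 19 := fatGraft_treeVec 6
  have f7 : fatGraft (treeVec 7) = treeVec 20 := fatGraft_treeVec 7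
  have q0 : (1 / 2 : ℝ) • pairGraft (treeVec 0) (treeVec 0) = treeVec 3 := by
    simp [pairGraft, bilinGraft_apply]; simp [treeVec]
  have q1 : pairGraft (treeVec 0) (treeVec 1) = treeVec 9 := by
    simp [pairGraft, bilinGraft_apply]; simp [treeVec]
  have q2 : pairGraft (treeVec 0) (treeVec 2) = treeVec 10 := by
    simp [pairGraft, bilinGraft_apply]; simp [treeVec]
  have c0 : (1 / 6 : ℝ) • tripleGraft (treeVec 0) (treeVec 0) (treeVec 0) = treeVec 8 := by
    rw [tripleGraft_apply]; simp [treeVec]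
  simp only [scaledDiff, h0, h1, h2, h3, m0, m1, m2, m3, m4, m5, m6, m7, f0, f1, f2, f3, f4, f5, f6,
    f7, q0, q1, q2, c0]
  fin_cases i <;> rfl

theorem bSeries4_universalField_apply (a : Fin 21 → ℝ) (h : ℝ) (i : Fin 21) :
    bSeries4 a fatGraft universalField 0 h i = a i * h ^ TWTree.ord i := by
  simp [bSeries4_eq_sum, scaledDiff_universalField, treeVec, Pi.single_apply]

theorem isBigO_apply {N : ℕ} {g : ℝ → Rn N} {n : ℕ} (hg : g =O[𝓝[>] (0 : ℝ)] fun h => h ^ n)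
    (i : Fin N) : (fun h => g h i) =O[𝓝[>] (0 : ℝ)] fun h => h ^ n :=
  ((EuclideanSpace.proj i : Rn N →L[ℝ] ℝ).isBigO_comp g _).trans hg

/-- Coordinate `i` of the difference of the two series is a constant times `h ^ ord i` with `ord i ≤
4`, and is `O(h ^ 5)` only if the constant vanishes. -/
theorem coeff_unique {a b : Fin 21 → ℝ} {g : ℝ → Rn 21}
    (ha : (fun h => g h - bSeries4 a fatGraft universalField 0 h) =O[𝓝[>] (0 : ℝ)] fun h => h ^ 5)
    (hb : (fun h => g h - bSeries4 b fatGraft universalField 0 h) =O[𝓝[>] (0 : ℝ)]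
      fun h => h ^ 5) : a = b := by
  ext i
  have h1 := isBigO_apply (hb.sub ha) i
  refine sub_eq_zero.1 (eq_zero_of_isBigO_pow (k := TWTree.ord i)
    (Nat.lt_succ_of_le (TWTree.ord_le i)) (h1.congr_left fun h => ?_))
  simp only [PiLp.sub_apply, bSeries4_universalField_apply]
  ring

/-- With `V` the identity, every matrix has the form `V H Vᵀ`; this admits `fatGraft` as the matrix
of a method. -/
theorem approxJac_id {N : ℕ} (A : Rn N →L[ℝ] Rn N) : approxJac LinearIsometry.id A = A := by
  ext1 x
  have : tr (LinearIsometry.id : Rn N →ₗᵢ[ℝ] Rn N) x = x := tr_apply_self LinearIsometry.id x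
  simp [approxJac_apply, this]

theorem HasBSeries.unique {Φ : Method} {a b : Fin 21 → ℝ} (ha : HasBSeries Φ a)
    (hb : HasBSeries Φ b) : a = b := by
  have h (c : Fin 21 → ℝ) (hc : HasBSeries Φ c) :=
    hc 21 21 universalField 0 LinearIsometry.id fatGraft contDiff_universalField
  simp only [approxJac_id] at h
  exact coeff_unique (h a ha) (h b hb)

theorem ExactHasBSeries.unique {a b : Fin 21 → ℝ} (ha : ExactHasBSeries a)
    (hb : ExactHasBSeries b) : a = b := by
  obtain ⟨z, hz⟩ := exists_isSolution contDiff_universalField 0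
  exact coeff_unique (ha 21 universalField 0 fatGraft z contDiff_universalField hz)
    (hb 21 universalField 0 fatGraft z contDiff_universalField hz)

end Universal

/-! ### Krylov spaces and order conditions -/

section Orders

theorem approxJac_reducedJac_apply {N m : ℕ} (V : Rn m →ₗᵢ[ℝ] Rn N) (J : Rn N →L[ℝ] Rn N)
    (x : Rn N) : approxJac V (reducedJac V J) x = V (tr V (J (V (tr V x)))) := rfl

theorem IsKrylovBasis.proj_pow_apply {N m M : ℕ} {J : Rn N →L[ℝ] Rn N} {v : Rn N}
    {V : Rn m →ₗᵢ[ℝ] Rn N} (hV : IsKrylovBasis M J v V) {i : ℕ} (hi : i < M) :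
    V (tr V ((J ^ i) v)) = (J ^ i) v := by
  have hmem : (J ^ i) v ∈ LinearMap.range V.toLinearMap := by
    rw [show LinearMap.range V.toLinearMap = _ from hV]
    exact Submodule.subset_span ⟨⟨i, hi⟩, rfl⟩
  obtain ⟨x, hx⟩ := hmem
  rw [← hx]
  exact congrArg V (tr_apply_self V x)

/-- On the Krylov space, apart from the last Krylov vector, the Jacobian is reproduced. -/
theorem IsKrylovBasis.approxJac_pow_apply {N m M : ℕ} {J : Rn N →L[ℝ] Rn N} {v : Rn N}
    {V : Rn m →ₗᵢ[ℝ] Rn N} (hV : IsKrylovBasis M J v V) {i : ℕ} (hi : i + 1 < M) :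
    approxJac V (reducedJac V J) ((J ^ i) v) = (J ^ (i + 1)) v := by
  have hs : J ((J ^ i) v) = (J ^ (i + 1)) v := by rw [pow_succ']; rfl
  rw [approxJac_reducedJac_apply, hV.proj_pow_apply (by omega), hs, hV.proj_pow_apply hi]

/-- The series of the exact solution may be written with any matrix, in particular with the `A` of
the method, so the two series subtract coefficientwise. -/
theorem HasBSeries.isBigO_sub_solution {Φ : Method} {a : Fin 21 → ℝ} (ha : HasBSeries Φ a)
    {N m : ℕ} {f : Rn N → Rn N} {y : Rn N} (V : Rn m →ₗᵢ[ℝ] Rn N) (H : Rn m →L[ℝ] Rn m)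
    {z : ℝ → Rn N} (hf : ContDiff ℝ ∞ f) (hz : IsSolution f y z) :
    (fun h => Φ N m f y V H h - z h -
        h • expansion (a - exactCoeff) (scaledDiff (approxJac V H) f y) h)
      =O[𝓝[>] (0 : ℝ)] fun h => h ^ 5 := by
  refine ((ha N m f y V H hf).sub
    (exactHasBSeries_exactCoeff N f y (approxJac V H) z hf hz)).congr_left fun h => ?_
  rw [bSeries4_eq, bSeries4_eq, expansion_sub]
  module

section Merged

variable {N m M : ℕ} {f : Rn N → Rn N} {y : Rn N} {V : Rn m →ₗᵢ[ℝ] Rn N}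
  (hV : IsKrylovBasis M (fderiv ℝ f y) (f y) V) (b : Fin 21 → ℝ)
include hV

theorem IsKrylovBasis.term₁_eq (hM : 3 ≤ M) :
    term₁ b (scaledDiff (approxJac V (reducedJac V (fderiv ℝ f y))) f y) =
      (b 1 + b 2) • fderiv ℝ f y (f y) := by
  have h1 := hV.approxJac_pow_apply (i := 0) (by omega)
  simp only [pow_zero, zero_add, pow_one, one_apply_eq_self] at h1
  simp [term₁, scaledDiff, h1]
  module

theorem IsKrylovBasis.term₂_eq (hM : 3 ≤ M) :
    term₂ b (scaledDiff (approxJac V (reducedJac V (fderiv ℝ f y))) f y) =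
      b 3 • (1 / 2 : ℝ) • secondDeriv f y (f y) (f y) +
      (b 4 + b 5 + b 6 + b 7) • fderiv ℝ f y (fderiv ℝ f y (f y)) := by
  have h1 := hV.approxJac_pow_apply (i := 0) (by omega)
  have h2 := hV.approxJac_pow_apply (i := 1) (by omega)
  simp only [pow_zero, zero_add, pow_one, one_apply_eq_self] at h1
  simp only [pow_succ, pow_zero, one_mul, mul_apply_eq_comp] at h2
  simp [term₂, scaledDiff, h1, h2]
  module

/-- `M ≥ 4` is what allows replacing `A J² f` by `J³ f`, hence merging all linear trees of order
four. The second derivative may leave the Krylov space, so the coefficients `b 11` and `b 12` stay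
separate. -/
theorem IsKrylovBasis.term₃_eq (hM : 4 ≤ M) :
    term₃ b (scaledDiff (approxJac V (reducedJac V (fderiv ℝ f y))) f y) =
      b 8 • (1 / 6 : ℝ) • thirdDeriv f y (f y) (f y) (f y) +
      (b 9 + b 10) • secondDeriv f y (f y) (fderiv ℝ f y (f y)) +
      b 11 • fderiv ℝ f y ((1 / 2 : ℝ) • secondDeriv f y (f y) (f y)) +
      b 12 • approxJac V (reducedJac V (fderiv ℝ f y))
        ((1 / 2 : ℝ) • secondDeriv f y (f y) (f y)) +
      (b 13 + b 14 + b 15 + b 16 + b 17 + b 18 + b 19 + b 20) •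
        fderiv ℝ f y (fderiv ℝ f y (fderiv ℝ f y (f y))) := by
  have h1 := hV.approxJac_pow_apply (i := 0) (by omega)
  have h2 := hV.approxJac_pow_apply (i := 1) (by omega)
  have h3 := hV.approxJac_pow_apply (i := 2) (by omega)
  simp only [pow_zero, zero_add, pow_one, one_apply_eq_self] at h1
  simp only [pow_succ, pow_zero, one_mul, mul_apply_eq_comp] at h2 h3
  simp [term₃, scaledDiff, h1, h2, h3]
  module

end Merged

theorem HasBSeries.hasOrder_three {Φ : Method} {a : Fin 21 → ℝ} (ha : HasBSeries Φ a)
    (h0 : a 0 = 1) (h1 : a 1 + a 2 = 1 / 2) (h3 : a 3 = 1 / 3)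
    (h4 : a 4 + a 5 + a 6 + a 7 = 1 / 6) {M : ℕ} (hM : 3 ≤ M) (m : ℕ) : HasOrder Φ M m 3 := by
  intro N f y V z hf hV hz
  have key := (ha.isBigO_sub_solution V (reducedJac V (fderiv ℝ f y)) hf hz).pow_mono
    (m := 4) (by norm_num)
  have e0 : (a - exactCoeff) 0 = 0 := by simp [exactCoeff, h0]
  have e1 : (a - exactCoeff) 1 + (a - exactCoeff) 2 = 0 := by
    simp [exactCoeff]; linarith
  have e3 : (a - exactCoeff) 3 = 0 := by simp [exactCoeff, h3]
  have e4 : (a - exactCoeff) 4 + (a - exactCoeff) 5 + (a - exactCoeff) 6 + (a - exactCoeff) 7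
      = 0 := by
    simp [exactCoeff]; linarith
  -- The terms at trees of order four are themselves `O(h ^ 4)` and are discarded unsimplified;
  -- therefore `M ≥ 3` suffices.
  refine (key.add (isBigO_pow_smul_const 4 (term₃ (a - exactCoeff)
    (scaledDiff (approxJac V (reducedJac V (fderiv ℝ f y))) f y)))).congr_left fun h => ?_
  rw [expansion, hV.term₁_eq _ hM, hV.term₂_eq _ hM, term₀, e0, e1, e3, e4]
  module

theorem HasBSeries.hasOrder_four {Φ : Method} {a : Fin 21 → ℝ} (ha : HasBSeries Φ a)
    (h0 : a 0 = 1) (h1 : a 1 + a 2 = 1 / 2) (h3 : a 3 = 1 / 3)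
    (h4 : a 4 + a 5 + a 6 + a 7 = 1 / 6) (h8 : a 8 = 1 / 4) (h9 : a 9 + a 10 = 1 / 8)
    (h11 : a 11 = 1 / 12) (h12 : a 12 = 0)
    (h13 : a 13 + a 14 + a 15 + a 16 + a 17 + a 18 + a 19 + a 20 = 1 / 24)
    {M : ℕ} (hM : 4 ≤ M) (m : ℕ) : HasOrder Φ M m 4 := by
  intro N f y V z hf hV hz
  have key := ha.isBigO_sub_solution V (reducedJac V (fderiv ℝ f y)) hf hz
  have e0 : (a - exactCoeff) 0 = 0 := by simp [exactCoeff, h0]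
  have e1 : (a - exactCoeff) 1 + (a - exactCoeff) 2 = 0 := by
    simp [exactCoeff]; linarith
  have e3 : (a - exactCoeff) 3 = 0 := by simp [exactCoeff, h3]
  have e4 : (a - exactCoeff) 4 + (a - exactCoeff) 5 + (a - exactCoeff) 6 + (a - exactCoeff) 7
      = 0 := by
    simp [exactCoeff]; linarith
  have e8 : (a - exactCoeff) 8 = 0 := by simp [exactCoeff, h8]
  have e9 : (a - exactCoeff) 9 + (a - exactCoeff) 10 = 0 := by
    simp [exactCoeff]; linarith
  have e11 : (a - exactCoeff) 11 = 0 := by simp [exactCoeff, h11]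
  have e12 : (a - exactCoeff) 12 = 0 := by simp [exactCoeff, h12]
  have e13 : (a - exactCoeff) 13 + (a - exactCoeff) 14 + (a - exactCoeff) 15 +
      (a - exactCoeff) 16 + (a - exactCoeff) 17 + (a - exactCoeff) 18 + (a - exactCoeff) 19 +
      (a - exactCoeff) 20 = 0 := by
    simp [exactCoeff]; linarith
  refine key.congr_left fun h => ?_
  rw [expansion, hV.term₁_eq _ (by omega), hV.term₂_eq _ (by omega), hV.term₃_eq _ hM, term₀, e0,
    e1, e3, e4, e8, e9, e11, e12, e13]
  module

end Orders

/-! ### Failure of order four -/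

section Counterexample

variable (k : ℕ)

/-- The embedding of `ℝᵏ` into `ℝᵏ⁺¹` as a coordinate subspace. -/
noncomputable def snocZero : Rn k →ₗᵢ[ℝ] Rn (k + 1) where
  toFun x := WithLp.toLp 2 (Fin.snoc (α := fun _ => ℝ) (fun i => x i) 0)
  map_add' x y := by
    ext i
    refine Fin.lastCases ?_ (fun i => ?_) i <;> simp
  map_smul' c x := by
    ext i
    refine Fin.lastCases ?_ (fun i => ?_) i <;> simp
  norm_map' x := by
    simp [EuclideanSpace.norm_eq, Fin.sum_univ_castSucc]

theorem snocZero_last (x : Rn k) : snocZero k x (Fin.last k) = 0 := by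
  simp [snocZero]

theorem snocZero_single (i : Fin k) :
    snocZero k (EuclideanSpace.single i 1) = EuclideanSpace.single i.castSucc 1 := by
  ext j
  refine Fin.lastCases ?_ (fun j => ?_) j
  · simp [snocZero]
  · simp [snocZero]

theorem range_snocZero : LinearMap.range (snocZero k).toLinearMap =
    Submodule.span ℝ (Set.range fun i : Fin k => EuclideanSpace.single i.castSucc (1 : ℝ)) := by
  rw [LinearMap.range_eq_map, ← (EuclideanSpace.basisFun (Fin k) ℝ).toBasis.span_eq,
    Submodule.map_span, ← Set.range_comp]
  congr 2
  ext1 i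
  simpa using snocZero_single k i

/-- The shift of the first `k + 1` coordinates, and the identity on the last coordinate. -/
noncomputable def shiftMap : Rn (k + 2) →L[ℝ] Rn (k + 2) :=
  ∑ i : Fin k, (EuclideanSpace.proj i.castSucc.castSucc : Rn (k + 2) →L[ℝ] ℝ).smulRight
      (EuclideanSpace.single i.succ.castSucc 1) +
    (EuclideanSpace.proj (Fin.last (k + 1)) : Rn (k + 2) →L[ℝ] ℝ).smulRight
      (EuclideanSpace.single (Fin.last (k + 1)) 1)

theorem shiftMap_single (i : Fin k) :
    shiftMap k (EuclideanSpace.single i.castSucc.castSucc 1) =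
      EuclideanSpace.single i.succ.castSucc 1 := by
  simp [shiftMap, Fin.castSucc_ne_last]

theorem shiftMap_last (x : Rn (k + 2)) : shiftMap k x (Fin.last (k + 1)) = x (Fin.last (k + 1)) := by
  simp [shiftMap]

theorem shiftMap_pow_single (i : Fin (k + 1)) :
    (shiftMap k ^ (i : ℕ)) (EuclideanSpace.single 0 1) = EuclideanSpace.single i.castSucc 1 := by
  refine Fin.induction ?_ (fun i hi => ?_) i
  · simp
  · rw [Fin.val_succ, pow_succ', mul_apply_eq_comp, ← shiftMap_single, ← hi]
    rfl

/-- The square of the first coordinate, as a bilinear map into the last coordinate. -/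
noncomputable def squareMap : Rn (k + 2) →L[ℝ] Rn (k + 2) →L[ℝ] Rn (k + 2) :=
  (EuclideanSpace.proj 0 : Rn (k + 2) →L[ℝ] ℝ).smulRight
    ((EuclideanSpace.proj 0 : Rn (k + 2) →L[ℝ] ℝ).smulRight
      (EuclideanSpace.single (Fin.last (k + 1)) 2))

theorem squareMap_apply_last (u v : Rn (k + 2)) :
    squareMap k u v (Fin.last (k + 1)) = 2 * u 0 * v 0 := by
  simp [squareMap]
  ring

/-- A vector field with an invariant Krylov space for which the second derivative leaves this
space. -/
noncomputable def leakyField : Rn (k + 2) → Rn (k + 2) :=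
  cubicMap (EuclideanSpace.single 0 1) (shiftMap k) (squareMap k) 0

theorem squareMap_symm (u v : Rn (k + 2)) : squareMap k u v = squareMap k v u := by
  simp [squareMap, smul_smul, mul_comm]

theorem leakyField_zero : leakyField k 0 = EuclideanSpace.single 0 1 := cubicMap_zero _ _ _ _

theorem fderiv_leakyField : fderiv ℝ (leakyField k) 0 = shiftMap k :=
  fderiv_cubicMap_zero _ _ _ _ (squareMap_symm k) (fun _ _ => rfl) fun _ _ _ => rfl

theorem secondDeriv_leakyField : secondDeriv (leakyField k) 0 = squareMap k :=
  secondDeriv_cubicMap_zero _ _ _ _ (squareMap_symm k) (fun _ _ => rfl) fun _ _ _ => rfl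

theorem thirdDeriv_leakyField : thirdDeriv (leakyField k) 0 = 0 :=
  thirdDeriv_cubicMap_zero _ _ _ _ (squareMap_symm k) (fun _ _ => rfl) fun _ _ _ => rfl

/-- The powers of the shift carry the first basis vector through the first `k + 1` basis vectors, so
there is no breakdown: the Krylov space has the full dimension `M = k + 1`. -/
theorem isKrylovBasis_snocZero :
    IsKrylovBasis (k + 1) (fderiv ℝ (leakyField k) 0) (leakyField k 0) (snocZero (k + 1)) := by
  rw [IsKrylovBasis, range_snocZero, fderiv_leakyField, leakyField_zero]
  simp only [shiftMap_pow_single]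

/-- The last coordinate is orthogonal to the Krylov space, so it vanishes on the range of `A` and
`J` leaves it unchanged. Only the second derivative at `(f, f)` feeds it, and only this vector and
its image under `J` remain. -/
theorem expansion_leakyField_last (hk : 2 ≤ k) (b : Fin 21 → ℝ) (h : ℝ) :
    expansion b (scaledDiff (approxJac (snocZero (k + 1))
      (reducedJac (snocZero (k + 1)) (fderiv ℝ (leakyField k) 0))) (leakyField k) 0) h
        (Fin.last (k + 1)) = h ^ 2 * b 3 + h ^ 3 * b 11 := by
  have hV := isKrylovBasis_snocZero k
  have h1 := hV.approxJac_pow_apply (i := 0) (by omega)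
  simp only [pow_zero, zero_add, pow_one, one_apply_eq_self] at h1
  have hA (x : Rn (k + 2)) : approxJac (snocZero (k + 1)) (reducedJac (snocZero (k + 1))
      (fderiv ℝ (leakyField k) 0)) x (Fin.last (k + 1)) = 0 := snocZero_last _ _
  -- `squareMap` sees only the first coordinates of its arguments, so this eliminates the trees `tau
  -- 9` and `tau 10`.
  have hJe : shiftMap k (EuclideanSpace.single 0 1) 0 = 0 := by
    have := shiftMap_single k ⟨0, by omega⟩
    rw [show (Fin.castSucc (Fin.castSucc (⟨0, by omega⟩ : Fin k)) : Fin (k + 2)) = 0 from rfl]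
      at this
    rw [this]
    simp
  generalize approxJac (snocZero (k + 1)) (reducedJac (snocZero (k + 1))
      (fderiv ℝ (leakyField k) 0)) = A at *
  simp only [leakyField_zero, fderiv_leakyField] at h1
  simp [expansion, term₀, term₁, term₂, term₃, scaledDiff, leakyField_zero, fderiv_leakyField,
    secondDeriv_leakyField, thirdDeriv_leakyField, hA, shiftMap_last, h1, hJe,
    squareMap_apply_last]

theorem HasBSeries.not_hasOrder_four {Φ : Method} {a : Fin 21 → ℝ} (ha : HasBSeries Φ a)
    (h3 : a 3 = 1 / 3) (h11 : a 11 ≠ 1 / 12) {M : ℕ} (hM : 3 ≤ M) : ¬ HasOrder Φ M M 4 := by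
  obtain ⟨k, rfl⟩ : ∃ k, M = k + 1 := ⟨M - 1, by omega⟩
  intro hΦ
  have hf : ContDiff ℝ ∞ (leakyField k) := contDiff_cubicMap _ _ _ _
  obtain ⟨z, hz⟩ := exists_isSolution hf 0
  have o1 := hΦ (k + 2) (leakyField k) 0 (snocZero (k + 1)) z hf (isKrylovBasis_snocZero k) hz
  have o2 := ha.isBigO_sub_solution (snocZero (k + 1))
    (reducedJac (snocZero (k + 1)) (fderiv ℝ (leakyField k) 0)) hf hz
  have o3 := isBigO_apply (o1.sub o2) (Fin.last (k + 1))
  refine h11 (sub_eq_zero.1 (eq_zero_of_isBigO_pow (k := 4) (n := 5) (by norm_num)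
    (o3.congr_left fun h => ?_)))
  -- The difference of the two `O(h ^ 5)` terms is `h` times the error expansion. Its term at `tau
  -- 3` vanishes by `h3`, and `(a 11 - 1 / 12) h ^ 4` is left.
  rw [sub_sub_cancel, PiLp.smul_apply, expansion_leakyField_last k (by omega)]
  simp [exactCoeff, h3]
  ring

end Counterexample

/-! ### The main theorem -/

theorem mainTheorem5 :
    -- `tau` lists every TW-tree of order at most four exactly once
    ((∀ t : TWTree, t.order ≤ 4 ↔ ∃ i, TWTree.Iso t (TWTree.tau i)) ∧
      (∀ i j, TWTree.Iso (TWTree.tau i) (TWTree.tau j) → i = j)) ∧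
    -- the B-series coefficients up to order four
    ((∀ a, HasBSeries exp4k a ↔ a = exp4kCoeff) ∧
      (∀ a, HasBSeries exp4sp a ↔ a = exp4spCoeff) ∧
      (∀ a, HasBSeries erow4k a ↔ a = erow4kCoeff) ∧
      (∀ a, HasBSeries erow4sp a ↔ a = erow4spCoeff) ∧
      (∀ a, ExactHasBSeries a ↔ a = exactCoeff)) ∧
    -- exp4k satisfies all order conditions at the TK-trees of order at most four
    ((∀ j, TWTree.IsTK (TWTree.tau j) → KCondition exp4kCoeff j) ∧
    -- among them the additional one, at the tree number 13 (`A_{JK} f^K_{LM} f^L f^M`)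
      (TWTree.IsTK (TWTree.tau 12) ∧ mergedCoeff exactCoeff 12 = 0 ∧ exp4kCoeff 12 = 0 ∧
        KCondition exp4kCoeff 12) ∧
    -- the other methods violate exactly the conditions at the trees number 12 and 13
      (∀ j, TWTree.IsTK (TWTree.tau j) → (KCondition exp4spCoeff j ↔ j ≠ 11 ∧ j ≠ 12)) ∧
      (∀ j, TWTree.IsTK (TWTree.tau j) → (KCondition erow4kCoeff j ↔ j ≠ 11 ∧ j ≠ 12)) ∧
      (∀ j, TWTree.IsTK (TWTree.tau j) → (KCondition erow4spCoeff j ↔ j ≠ 11 ∧ j ≠ 12))) ∧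
    -- the orders of the methods
    ((∀ M, 4 ≤ M → ∀ m, HasOrder exp4k M m 4) ∧
      (∀ M, 3 ≤ M → (∀ m, HasOrder exp4sp M m 3) ∧ ¬ HasOrder exp4sp M M 4) ∧
      (∀ M, 3 ≤ M → (∀ m, HasOrder erow4k M m 3) ∧ ¬ HasOrder erow4k M M 4) ∧
      (∀ M, 3 ≤ M → (∀ m, HasOrder erow4sp M m 3) ∧ ¬ HasOrder erow4sp M M 4)) := by
  refine ⟨⟨TWTree.order_le_four_iff, fun i j => TWTree.tau_injective⟩, ⟨?_, ?_, ?_, ?_, ?_⟩,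
    ⟨fun j => kCondition_exp4k, ⟨?_, ?_, rfl, ?_⟩, fun j => kCondition_exp4sp_iff,
      fun j => kCondition_erow4k_iff, fun j => kCondition_exp4sp_iff⟩, ?_, ?_, ?_, ?_⟩
  · exact fun a => ⟨fun h => h.unique hasBSeries_exp4k, fun h => h ▸ hasBSeries_exp4k⟩
  · exact fun a => ⟨fun h => h.unique hasBSeries_exp4sp, fun h => h ▸ hasBSeries_exp4sp⟩
  · exact fun a => ⟨fun h => h.unique hasBSeries_erow4k, fun h => h ▸ hasBSeries_erow4k⟩
  · exact fun a => ⟨fun h => h.unique hasBSeries_erow4sp, fun h => h ▸ hasBSeries_erow4sp⟩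
  · exact fun a => ⟨fun h => h.unique exactHasBSeries_exactCoeff,
      fun h => h ▸ exactHasBSeries_exactCoeff⟩
  · simp [TWTree.isTK_tau_iff]
  · simp [mergedCoeff_eq_vec, exactCoeff]
  · exact kCondition_exp4k (by simp [TWTree.isTK_tau_iff])
  · intro M hM m
    refine hasBSeries_exp4k.hasOrder_four ?_ ?_ ?_ ?_ ?_ ?_ ?_ ?_ ?_ hM m <;>
      simp [exp4kCoeff] <;> norm_num
  · refine fun M hM => ⟨fun m => hasBSeries_exp4sp.hasOrder_three ?_ ?_ ?_ ?_ hM m,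
      hasBSeries_exp4sp.not_hasOrder_four ?_ ?_ hM⟩ <;> simp [exp4spCoeff]
  · refine fun M hM => ⟨fun m => hasBSeries_erow4k.hasOrder_three ?_ ?_ ?_ ?_ hM m,
      hasBSeries_erow4k.not_hasOrder_four ?_ ?_ hM⟩ <;> simp [erow4kCoeff] <;> norm_num
  · refine fun M hM => ⟨fun m => hasBSeries_erow4sp.hasOrder_three ?_ ?_ ?_ ?_ hM m,
      hasBSeries_erow4sp.not_hasOrder_four ?_ ?_ hM⟩ <;> simp [erow4spCoeff]
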